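/- **Setting.** Let $J(r,r')\ge 0$ be a smooth, symmetric, translation invariant probability kernel on $\mathbb R$ ($\int J(r,r')\,dr'=1$) with $J(r,r')=0$ for $|r-r'|\ge 1$. For $\gamma>0$ put $J_\gamma(x,y)=c_\gamma\gamma J(\gamma x,\gamma y)$, $x,y\in\mathbb Z$, where $c_\gamma$ is such that $\sum_{y\in\mathbb Z}J_\gamma(x,y)=1$ (such $c_\gamma$ exists for all small $\gamma$; if $\sum_y \gamma J(\gamma x,\gamma y)=0$ we put $c_\gamma=0$), and let $J_{\gamma,L}(x,y)=\sum_{k\in\mathbb Z}J_\gamma(x,y+kL)$. Let $\Lambda=\{1,\dots,L\}^2$ with points $(x,i)$ ($i$ is the layer). For $\sigma\in\{-1,1\}^\Lambda$, with $\sigma(x,L+1)=\sigma(x,1)$, let $$H^{\rm per}_{\gamma,h_{\rm ext},L}(\sigma)=-\frac12\sum_{i=1}^L\sum_{x\ne y}J_{\gamma,L}(x,y)\sigma(x,i)\sigma(y,i)+H^{\rm vert}_L(\sigma)-h_{\rm ext}\sum_{(x,i)\in\Lambda}\sigma(x,i),$$ $$H^{\rm vert}_L(\sigma)=-\lambda\sum_{x=1}^L\sum_{i=1}^L\sigma(x,i)\sigma(x,i+1),$$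 and $Z^{\rm per}_{\gamma,h_{\rm ext},L}=\sum_{\sigma\in\{-1,1\}^\Lambda}e^{-H^{\rm per}_{\gamma,h_{\rm ext},L}(\sigma)}$. For $\ell\ge1$ let $\Delta=\{1,\dots,\ell\}^2$ and $\mathcal M_\ell=\{-1,-1+\frac2\ell,\dots,1-\frac2\ell,1\}$. For a function $m_\Delta(x,i)=m(i)$ on $\Delta$ that depends only on $i$ and has values in $\mathcal M_\ell$ let $$\phi_\ell(m_\Delta)=-\frac1{|\Delta|}\log\sum_{\sigma\in\{-1,1\}^\Delta}e^{-H^{\rm vert}_\ell(\sigma)}\,\mathbf 1\Big\{\frac1\ell\sum_{x=1}^{\ell}\sigma(x,i)=m(i)\ \text{for all } i\Big\},$$ and for $m_+\in(0,1)$ define $Z^{\rm max}_\Delta=Z^{\rm max}_\Delta(m_+)$ by $$\log Z^{\rm max}_\Delta=\max_{m_\Delta:\,|m_\Delta(x,i)|\le m_+}\ \sum_{(x,i)\in\Delta}\Big\{\frac{m_\Delta(x,i)^2}2+h_{\rm ext}\,m_\Delta(x,i)-\phi_\ell(m_\Delta)\Big\}$$ (for all large $\ell$ the maximum is over a non-empty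 set). Let $h^*>3$ be the number with $3/\cosh^2(h^*-3)=1/4$. **Theorem.** There is $m_+\in(0,1)$ such that for every kernel $J$ as above, every $\lambda\in[0,1)$ and every $h_{\rm ext}\in[0,h^*]$ the limit $P_\gamma=\lim_{L\to\infty}|\Lambda|^{-1}\log Z^{\rm per}_{\gamma,h_{\rm ext},L}$ exists for every $\gamma>0$, the limits below exist, and $$\lim_{\gamma\to0^+}\ \lim_{L\to\infty}\frac1{|\Lambda|}\log Z^{\rm per}_{\gamma,h_{\rm ext},L}=\lim_{|\Delta|\to\infty}\frac1{|\Delta|}\log Z^{\rm max}_\Delta(m_+).$$ -/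

import Mathlib

open Filter Topology
open scoped ContDiff

noncomputable section

namespace KacIsing

/-- The profile of a Kac potential: a smooth, symmetric, translation invariant probability kernel
on `ℝ` vanishing for `|r - r'| ≥ 1`. -/
structure IsKacKernel (J : ℝ → ℝ → ℝ) : Prop where
  smooth : ContDiff ℝ ∞ (Function.uncurry J)
  symm : ∀ r r', J r r' = J r' r
  translation : ∀ a r r', J (r + a) (r' + a) = J r r'
  nonneg : ∀ r r', 0 ≤ J r r'
  integral_eq_one : ∀ r, ∫ r', J r r' = 1
  support : ∀ r r', 1 ≤ |r - r'| → J r r' = 0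

/-- The constant `c_γ` that makes `y ↦ c_γ γ J(γ x, γ y)` sum to one over `ℤ`
(by translation invariance it is enough to look at `x = 0`, see `hasSum_kacCoupling`).
If the sum vanishes, which is possible only when `γ` is not small, then `c_γ = 0`. -/
def kacNorm (J : ℝ → ℝ → ℝ) (γ : ℝ) : ℝ := (∑' y : ℤ, γ * J 0 (γ * y))⁻¹

/-- `J_γ(x, y) = c_γ γ J(γ x, γ y)` on `ℤ`. -/
def kacCoupling (J : ℝ → ℝ → ℝ) (γ : ℝ) (x y : ℤ) : ℝ :=
  kacNorm J γ * γ * J (γ * x) (γ * y)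

theorem hasSum_kacCoupling {J : ℝ → ℝ → ℝ} (hJ : IsKacKernel J) (γ : ℝ)
    (h : ∑' y : ℤ, γ * J 0 (γ * y) ≠ 0) (x : ℤ) :
    HasSum (fun y => kacCoupling J γ x y) 1 := by
  have hs : Summable (fun y : ℤ => γ * J 0 (γ * y)) := by
    by_contra hn
    exact h (tsum_eq_zero_of_not_summable hn)
  have h1 := hs.hasSum.mul_left (kacNorm J γ)
  have h2 : kacNorm J γ * ∑' y : ℤ, γ * J 0 (γ * y) = 1 := inv_mul_cancel₀ h
  rw [h2] at h1
  have h3 := (Equiv.subRight x).hasSum_iff.mpr h1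
  refine h3.congr_fun ?_ 
  intro y
  have := hJ.translation (γ * x) 0 (γ * (y - x))
  simp only [Function.comp, Equiv.subRight_apply, kacCoupling, Int.cast_sub]
  rw [← this]
  ring_nf

/-- The Kac coupling on the cycle of length `L`: pairing a site `x` with the periodic extension of
the spins means summing the coupling over all the images `y + k L` of `y`. -/
def kacCouplingPer (J : ℝ → ℝ → ℝ) (γ : ℝ) (L : ℕ) (x y : Fin L) : ℝ :=
  ∑' k : ℤ, kacCoupling J γ ((x : ℕ) : ℤ) (((y : ℕ) : ℤ) + k * L)

/-- Spin configurations in the `L × L` square; `σ x i` is the spin at horizontal coordinate `x` in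
the layer `i`, and `ℤˣ = {1, -1}`. -/
abbrev SpinConfig (L : ℕ) : Type := Fin L → Fin L → ℤˣ

/-- The real value `±1` of a spin. -/
def spin (s : ℤˣ) : ℝ := ((s : ℤ) : ℝ)

/-- The Kac hamiltonian, acting inside each layer. -/
def kacEnergy (J : ℝ → ℝ → ℝ) (γ : ℝ) (L : ℕ) (σ : SpinConfig L) : ℝ :=
  ∑ i : Fin L, -(1 / 2 * ∑ x : Fin L, ∑ y ∈ Finset.univ.filter (fun y => y ≠ x),
    kacCouplingPer J γ L x y * spin (σ x i) * spin (σ y i))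

/-- The vertical nearest neighbour hamiltonian with periodic conditions; `finRotate L i` is the
layer `i + 1` modulo `L`. -/
def vertEnergy (lam : ℝ) (L : ℕ) (σ : SpinConfig L) : ℝ :=
  ∑ x : Fin L, -(lam * ∑ i : Fin L, spin (σ x i) * spin (σ x (finRotate L i)))

/-- The energy in the external field. -/
def fieldEnergy (h : ℝ) (L : ℕ) (σ : SpinConfig L) : ℝ :=
  -∑ x : Fin L, ∑ i : Fin L, h * spin (σ x i)

/-- The full hamiltonian on the torus. -/
def energy (J : ℝ → ℝ → ℝ) (lam γ h : ℝ) (L : ℕ) (σ : SpinConfig L) : ℝ :=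
  kacEnergy J γ L σ + vertEnergy lam L σ + fieldEnergy h L σ

/-- The partition function of the torus. -/
def partitionFunction (J : ℝ → ℝ → ℝ) (lam γ h : ℝ) (L : ℕ) : ℝ :=
  ∑ σ : SpinConfig L, Real.exp (-energy J lam γ h L σ)

/-- `{-1, -1 + 2/ℓ, …, 1 - 2/ℓ, 1}`, the possible averages of `ℓ` spins. -/
def magnetizations (ℓ : ℕ) : Set ℝ := {m | ∃ k : ℕ, k ≤ ℓ ∧ m = -1 + 2 * (k : ℝ) / ℓ}

open Classical in
/-- The canonical partition function of the vertical hamiltonian in the `ℓ × ℓ` square, where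
the average spin in the layer `i` is `m i`. -/
def constrainedPartition (lam : ℝ) (ℓ : ℕ) (m : Fin ℓ → ℝ) : ℝ :=
  ∑ σ ∈ Finset.univ.filter (fun σ : SpinConfig ℓ => ∀ i, ∑ x, spin (σ x i) = ℓ * m i),
    Real.exp (-vertEnergy lam ℓ σ)

/-- `φ_ℓ`, the multi-canonical free energy density. -/
def phi (lam : ℝ) (ℓ : ℕ) (m : Fin ℓ → ℝ) : ℝ :=
  -(1 / (ℓ : ℝ) ^ 2) * Real.log (constrainedPartition lam ℓ m)

/-- The admissible profiles, given by their value on each layer. -/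
def profiles (mplus : ℝ) (ℓ : ℕ) : Set (Fin ℓ → ℝ) :=
  {m | ∀ i, m i ∈ magnetizations ℓ ∧ |m i| ≤ mplus}

/-- The functional that is maximized over the profiles. -/
def profileValue (lam h : ℝ) (ℓ : ℕ) (m : Fin ℓ → ℝ) : ℝ :=
  ∑ _x : Fin ℓ, ∑ i : Fin ℓ, ((m i) ^ 2 / 2 + h * m i - phi lam ℓ m)

/-- `log Z^max`: the maximum of `profileValue` over the admissible profiles. The supremum is
attained as soon as there is a profile, see `isGreatest_logZmax`. -/
def logZmax (lam h mplus : ℝ) (ℓ : ℕ) : ℝ := sSup (profileValue lam h ℓ '' profiles mplus ℓ)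

theorem finite_profiles (mplus : ℝ) (ℓ : ℕ) : (profiles mplus ℓ).Finite := by
  have h1 : (magnetizations ℓ).Finite := by
    refine ((Set.finite_Iic ℓ).image (fun k : ℕ => -1 + 2 * (k : ℝ) / ℓ)).subset ?_
    rintro m ⟨k, hk, rfl⟩
    exact ⟨k, hk, rfl⟩
  exact (Set.Finite.pi' (fun _ : Fin ℓ => h1)).subset (fun m hm i => (hm i).1)

theorem isGreatest_logZmax (lam h mplus : ℝ) (ℓ : ℕ) (hne : (profiles mplus ℓ).Nonempty) :
    IsGreatest (profileValue lam h ℓ '' profiles mplus ℓ) (logZmax lam h mplus ℓ) := by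
  have hf := (finite_profiles mplus ℓ).image (profileValue lam h ℓ)
  exact ⟨(hne.image _).csSup_mem hf, fun _ hx => le_csSup hf.bddAbove hx⟩

end KacIsing

end

/-! The Kac interaction is weak and long ranged, so each column should feel the rest of the system
only through a field `a i` in layer `i`. Both sides of the identity are therefore compared with one
auxiliary quantity, `meanFieldPressure`: the supremum over `a` in `[-1, 1]^L` of the log partition
function of a single vertical chain in the field `h + a`, minus `∑ aᵢ² / 2`. The square is
linearized by `a m - a² / 2 ≤ m² / 2`, with equality at `a = m`.

Kac side. For the lower bound, the Gibbs variational principle is applied with independent identical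
columns as trial measure (`meanFieldValue_le_torusPressure`). For the upper bound, each layer is cut
into blocks of fixed length `n` and the spins in the Kac energy are replaced by block averages
(`torusPressure_le`). The kernel has range of order `1 / γ` and varies by order `n γ²` over a block,
so the energy error per site is of order `n γ`. There are at most `n + 1` averages per block and
layer, which costs about `log (n + 1) / n` per site. Taking `n` large, then `γ` small, then `L`
large makes the pressure and `meanFieldPressure / L` arbitrarily close
(`eventually_abs_pressure_sub_le`).

Limits. For fixed `γ` the torus pressure is additive under concatenation in either direction up to a
boundary term, so it converges. Its closeness to `meanFieldPressure / L`, which does not depend on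
`γ`, makes that sequence Cauchy and identifies its limit with the limit of `P γ`
(`exists_tendsto_of_eventually_abs_sub_le`).

Profile side. Sorting the configurations of `ℓ` independent columns by their layer magnetizations
turns `ℓ * meanFieldPressure` into a maximum over profiles, up to the log of the number of profiles.
The cutoff `mplus` is harmless: flipping one spin costs bounded energy, so the mean spin in a
bounded field stays uniformly away from `±1`, and a Chernoff bound makes larger layer magnetizations
unlikely in all layers at once (`half_le_gibbs_layers`, `nonempty_profiles_and_meanFieldValue_le`).
-/

namespace KacIsing

/-! ### Periodization of a kernel of finite range -/

/-- The sum of a function on `ℤ` over the translates of `u` by multiples of `L`. -/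
noncomputable def periodize (g : ℤ → ℝ) (L : ℕ) (u : ℤ) : ℝ := ∑' k : ℤ, g (u + k * L)

/-- A nonnegative function on `ℤ` which vanishes outside of `(-R, R)`. -/
structure IsFiniteRange (g : ℤ → ℝ) (R : ℕ) : Prop where
  nonneg : ∀ u, 0 ≤ g u
  range : ∀ u : ℤ, (R : ℤ) ≤ |u| → g u = 0

namespace IsFiniteRange

variable {g : ℤ → ℝ} {R : ℕ}

theorem summable (hg : IsFiniteRange g R) : Summable g := by
  refine summable_of_hasFiniteSupport ((Set.finite_Ioo (-(R : ℤ)) R).subset ?_)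
  intro u hu
  by_contra h
  refine hu (hg.range u ?_)
  by_contra h'
  exact h (abs_lt.mp (not_le.mp h'))

theorem tsum_nonneg (hg : IsFiniteRange g R) : 0 ≤ ∑' u, g u := _root_.tsum_nonneg hg.nonneg

end IsFiniteRange

theorem injective_add_mul {L : ℕ} (hL : 0 < L) (u : ℤ) :
    Function.Injective (fun k : ℤ => u + k * L) := by
  intro a b h
  have h' : a * (L : ℤ) = b * L := by simpa using h
  exact mul_right_cancel₀ (by positivity) h'

theorem summable_periodize {g : ℤ → ℝ} (hg : Summable g) {L : ℕ} (hL : 0 < L) (u : ℤ) :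
    Summable (fun k : ℤ => g (u + k * L)) :=
  hg.comp_injective (injective_add_mul hL u)

/-- Division with remainder by `L` identifies `ℤ` with pairs (image, site of the cycle).
Periodization thus preserves the total mass, even when the range exceeds `L`. -/
theorem sum_periodize {g : ℤ → ℝ} (hg : Summable g) {L : ℕ} (hL : 0 < L) (x : ℤ) :
    ∑ y : Fin L, periodize g L (((y : ℕ) : ℤ) - x) = ∑' u, g u := by
  have : NeZero L := ⟨hL.ne'⟩
  have h1 : ∑' u, g u = ∑' u : ℤ, g (u - x) := ((Equiv.subRight x).tsum_eq g).symm
  have hs : Summable (fun u : ℤ => g (u - x)) := (Equiv.subRight x).summable_iff.mpr hg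
  rw [h1, ← (Int.divModEquiv L).symm.tsum_eq]
  have hs' := (Int.divModEquiv L).symm.summable_iff.mpr hs
  change _ = ∑' p, ((fun u => g (u - x)) ∘ (Int.divModEquiv L).symm) p
  rw [Summable.tsum_prod hs']
  have h2 : ∀ (k : ℤ) (y : Fin L), ((fun u => g (u - x)) ∘ (Int.divModEquiv L).symm) (k, y) =
      g (((y : ℕ) : ℤ) - x + k * L) := fun k y => by
    change g (k * (L : ℤ) + ((y : ℕ) : ℤ) - x) = _
    congr 1
    ring
  simp_rw [tsum_fintype]
  rw [Summable.tsum_finsetSum]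
  · refine Finset.sum_congr rfl fun y _ => tsum_congr fun k => ?_
    rw [h2]
  · intro y _
    simp_rw [h2]
    exact summable_periodize hg hL ((y : ℕ) - x)

theorem periodize_nonneg {g : ℤ → ℝ} (hg : ∀ u, 0 ≤ g u) (L : ℕ) (u : ℤ) : 0 ≤ periodize g L u :=
  tsum_nonneg fun _ => hg _

/-- The two conditions put every image with `k ≠ 0` at distance at least `R` from the origin, so
only the original point contributes. -/
theorem periodize_eq_self {g : ℤ → ℝ} {R : ℕ} (hg : IsFiniteRange g R) {L : ℕ} {u : ℤ}
    (h1 : (R : ℤ) ≤ u + L) (h2 : (R : ℤ) ≤ L - u) : periodize g L u = g u := by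
  unfold periodize
  rw [tsum_eq_single 0]
  · simp
  · intro k hk
    refine hg.range _ (le_abs.mpr ?_)
    rcases lt_or_gt_of_ne hk with h | h
    · right; nlinarith
    · left; nlinarith

theorem periodize_sub_comm {g : ℤ → ℝ} (hg : ∀ u, g (-u) = g u) (L : ℕ) (u : ℤ) :
    periodize g L (-u) = periodize g L u := by
  unfold periodize
  rw [← (Equiv.neg ℤ).tsum_eq]
  refine tsum_congr fun k => ?_
  rw [← hg]
  congr 1
  simp only [Equiv.neg_apply]
  ring

/-! ### Splitting the energies of one line -/

/-- The energy (with the sign changed) of a cycle of length `L` with a Kac interaction. -/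
noncomputable def kacLine (g : ℤ → ℝ) (L : ℕ) (τ : Fin L → ℝ) : ℝ :=
  1 / 2 * ∑ x : Fin L, ∑ y : Fin L,
    if y = x then 0 else periodize g L (((y : ℕ) : ℤ) - ((x : ℕ) : ℤ)) * τ x * τ y

/-- The nearest neighbour energy (with the sign changed) of a cycle of length `L`. -/
noncomputable def chainLine (lam : ℝ) (L : ℕ) (τ : Fin L → ℝ) : ℝ :=
  lam * ∑ i : Fin L, τ i * τ (finRotate L i)

theorem card_boundary_le (R m : ℕ) :
    (Finset.univ.filter (fun x : Fin m => ¬ (R ≤ (x : ℕ) ∧ (x : ℕ) + R < m))).card ≤ 2 * R := by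
  have h : ((Finset.univ.filter (fun x : Fin m => ¬ (R ≤ (x : ℕ) ∧ (x : ℕ) + R < m))).map
      Fin.valEmbedding) ⊆ Finset.range R ∪ Finset.Ico (m - R) m := by
    intro z hz
    simp only [Finset.mem_map, Finset.mem_filter, Finset.mem_univ, true_and,
      Fin.valEmbedding_apply] at hz
    obtain ⟨x, hx, rfl⟩ := hz
    simp only [Finset.mem_union, Finset.mem_range, Finset.mem_Ico]
    have := x.2
    omega
  have := (Finset.card_le_card h).trans (Finset.card_union_le _ _)
  simp only [Finset.card_map, Finset.card_range, Nat.card_Ico] at this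
  omega

/-- Used for surface errors: the bulk terms do not contribute and at most `2 * R` sites lie within
`R` of an end. -/
theorem sum_le_of_boundary {R m : ℕ} {c : ℝ} (hc : 0 ≤ c) {f : Fin m → ℝ}
    (h0 : ∀ x : Fin m, R ≤ (x : ℕ) → (x : ℕ) + R < m → f x ≤ 0) (h1 : ∀ x, f x ≤ c) :
    ∑ x, f x ≤ 2 * R * c := by
  calc ∑ x, f x ≤ ∑ x : Fin m, if ¬ (R ≤ (x : ℕ) ∧ (x : ℕ) + R < m) then c else 0 := by
        refine Finset.sum_le_sum fun x _ => ?_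
        by_cases h : R ≤ (x : ℕ) ∧ (x : ℕ) + R < m
        · simpa [h] using h0 x h.1 h.2
        · rw [if_pos h]
          exact h1 x
    _ = (Finset.univ.filter (fun x : Fin m => ¬ (R ≤ (x : ℕ) ∧ (x : ℕ) + R < m))).card * c := by
        rw [← Finset.sum_filter, Finset.sum_const, nsmul_eq_mul]
    _ ≤ 2 * R * c := by
        refine mul_le_mul_of_nonneg_right ?_ hc
        exact_mod_cast card_boundary_le R m

theorem abs_sum_row_le {g : ℤ → ℝ} {R : ℕ} (hg : IsFiniteRange g R) {L : ℕ} (τ : Fin L → ℝ)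
    (hτ : ∀ x, |τ x| ≤ 1) (x : Fin L) :
    |∑ y : Fin L, if y = x then 0 else
      periodize g L (((y : ℕ) : ℤ) - ((x : ℕ) : ℤ)) * τ x * τ y| ≤ ∑' u, g u := by
  have hL : 0 < L := x.pos
  rw [← sum_periodize hg.summable hL ((x : ℕ) : ℤ)]
  refine (Finset.abs_sum_le_sum_abs _ _).trans (Finset.sum_le_sum fun y _ => ?_)
  have hp := periodize_nonneg hg.nonneg L (((y : ℕ) : ℤ) - ((x : ℕ) : ℤ))
  split_ifs
  · simpa using hp
  · rw [abs_mul, abs_mul, abs_of_nonneg hp, mul_assoc]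
    exact mul_le_of_le_one_right hp (mul_le_one₀ (hτ x) (abs_nonneg _) (hτ y))

theorem abs_kacLine_le {g : ℤ → ℝ} {R : ℕ} (hg : IsFiniteRange g R) {L : ℕ} (τ : Fin L → ℝ)
    (hτ : ∀ x, |τ x| ≤ 1) : |kacLine g L τ| ≤ L * ∑' u, g u := by
  unfold kacLine
  have hG := hg.tsum_nonneg
  rw [abs_mul, abs_of_nonneg (by norm_num : (0 : ℝ) ≤ 1 / 2)]
  have h := (Finset.abs_sum_le_sum_abs _ _).trans
    (Finset.sum_le_sum fun x (_ : x ∈ (Finset.univ : Finset (Fin L))) => abs_sum_row_le hg τ hτ x)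
  simp only [Finset.sum_const, Finset.card_univ, Fintype.card_fin, nsmul_eq_mul] at h
  have : 0 ≤ (L : ℝ) * ∑' u, g u := by positivity
  linarith

/-- A site at distance at least `R` from both ends of its segment sees neither the other segment nor
the periodic closure, so its row of interactions is the same in both geometries. Each segment has at
most `2 * R` other sites, and at each the rows differ by at most twice the total mass; the factor `1
/ 2` in the energy gives `4 * R`. -/
theorem kacLine_append {g : ℤ → ℝ} {R : ℕ} (hg : IsFiniteRange g R) {m n : ℕ}
    (τ : Fin (m + n) → ℝ) (hτ : ∀ x, |τ x| ≤ 1) :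
    |kacLine g (m + n) τ - kacLine g m (fun x => τ (Fin.castAdd n x)) -
      kacLine g n (fun x => τ (Fin.natAdd m x))| ≤ 4 * R * ∑' u, g u := by
  have hG := hg.tsum_nonneg
  set E : ∀ (L : ℕ) (τ : Fin L → ℝ) (x : Fin L), ℝ := fun L τ x => ∑ y : Fin L, if y = x then 0 else
      periodize g L (((y : ℕ) : ℤ) - ((x : ℕ) : ℤ)) * τ x * τ y with hE
  have hb : ∀ (L : ℕ) (τ : Fin L → ℝ), (∀ x, |τ x| ≤ 1) → ∀ x, |E L τ x| ≤ ∑' u, g u :=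
    fun L τ hτ x => abs_sum_row_le hg τ hτ x
  have h1 : ∑ x : Fin m, |E (m + n) τ (Fin.castAdd n x) - E m (fun x => τ (Fin.castAdd n x)) x| ≤
      2 * R * (2 * ∑' u, g u) := by
    refine sum_le_of_boundary (by positivity) ?_ ?_
    · intro x hx1 hx2
      rw [abs_nonpos_iff, sub_eq_zero]
      simp only [hE, Fin.sum_univ_add]
      have h0 : ∑ y : Fin n, (if Fin.natAdd m y = Fin.castAdd n x then (0 : ℝ) else
          periodize g (m + n) (((Fin.natAdd m y : Fin (m + n)) : ℕ) -
          (((Fin.castAdd n x : Fin (m + n)) : ℕ) : ℤ)) * τ (Fin.castAdd n x) *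
          τ (Fin.natAdd m y)) = 0 := by
        refine Finset.sum_eq_zero fun y _ => ?_
        have := y.2
        rw [periodize_eq_self hg, hg.range]
        · simp
        all_goals simp only [Fin.val_natAdd, Fin.val_castAdd]; push_cast
        · rw [le_abs]; omega
        all_goals omega
      rw [h0, add_zero]
      refine Finset.sum_congr rfl fun y _ => ?_
      have := y.2
      rw [periodize_eq_self hg, periodize_eq_self hg]
      · simp only [Fin.val_castAdd, Fin.castAdd_inj]
      all_goals (try simp only [Fin.val_castAdd]); push_cast; omega
    · intro x
      refine (abs_sub _ _).trans ?_
      linarith [hb _ τ hτ (Fin.castAdd n x), hb _ (fun x => τ (Fin.castAdd n x)) (fun x => hτ _) x]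
  have h2 : ∑ x : Fin n, |E (m + n) τ (Fin.natAdd m x) - E n (fun x => τ (Fin.natAdd m x)) x| ≤
      2 * R * (2 * ∑' u, g u) := by
    refine sum_le_of_boundary (by positivity) ?_ ?_
    · intro x hx1 hx2
      rw [abs_nonpos_iff, sub_eq_zero]
      simp only [hE, Fin.sum_univ_add]
      have h0 : ∑ y : Fin m, (if Fin.castAdd n y = Fin.natAdd m x then (0 : ℝ) else
          periodize g (m + n) (((Fin.castAdd n y : Fin (m + n)) : ℕ) -
          (((Fin.natAdd m x : Fin (m + n)) : ℕ) : ℤ)) * τ (Fin.natAdd m x) *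
          τ (Fin.castAdd n y)) = 0 := by
        refine Finset.sum_eq_zero fun y _ => ?_
        have := y.2
        rw [periodize_eq_self hg, hg.range]
        · simp
        all_goals simp only [Fin.val_natAdd, Fin.val_castAdd]; push_cast
        · rw [le_abs]; omega
        all_goals omega
      rw [h0, zero_add]
      refine Finset.sum_congr rfl fun y _ => ?_
      have := y.2
      rw [periodize_eq_self hg, periodize_eq_self hg]
      · simp
      all_goals (try simp only [Fin.val_natAdd]); push_cast; omega
    · intro x
      refine (abs_sub _ _).trans ?_
      linarith [hb _ τ hτ (Fin.natAdd m x), hb _ (fun x => τ (Fin.natAdd m x)) (fun x => hτ _) x]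
  have h3 : kacLine g (m + n) τ - kacLine g m (fun x => τ (Fin.castAdd n x)) -
      kacLine g n (fun x => τ (Fin.natAdd m x)) =
      1 / 2 * (∑ x : Fin m, (E (m + n) τ (Fin.castAdd n x) - E m (fun x => τ (Fin.castAdd n x)) x) +
      ∑ x : Fin n, (E (m + n) τ (Fin.natAdd m x) - E n (fun x => τ (Fin.natAdd m x)) x)) := by
    have h : ∀ (L : ℕ) (τ : Fin L → ℝ), kacLine g L τ = 1 / 2 * ∑ x, E L τ x := fun _ _ => rfl
    rw [h, h, h, Fin.sum_univ_add, Finset.sum_sub_distrib, Finset.sum_sub_distrib]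
    ring
  rw [h3, abs_mul, abs_of_nonneg (by norm_num : (0 : ℝ) ≤ 1 / 2)]
  have h4 := (abs_add_le _ _).trans (add_le_add ((Finset.abs_sum_le_sum_abs _ _).trans h1)
    ((Finset.abs_sum_le_sum_abs _ _).trans h2))
  linarith

theorem abs_chainLine_le {lam : ℝ} (h0 : 0 ≤ lam) (h1 : lam ≤ 1) {L : ℕ} (τ : Fin L → ℝ)
    (hτ : ∀ x, |τ x| ≤ 1) : |chainLine lam L τ| ≤ L := by
  unfold chainLine
  rw [abs_mul, abs_of_nonneg h0]
  refine (mul_le_of_le_one_left (abs_nonneg _) h1).trans ?_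
  refine (Finset.abs_sum_le_sum_abs _ _).trans ?_
  have : ∀ i : Fin L, |τ i * τ (finRotate L i)| ≤ 1 := fun i => by
    rw [abs_mul]
    exact mul_le_one₀ (hτ _) (abs_nonneg _) (hτ _)
  simpa using Finset.sum_le_sum fun i (_ : i ∈ (Finset.univ : Finset (Fin L))) => this i

theorem val_finRotate_of_lt {L : ℕ} (i : Fin L) (hi : (i : ℕ) + 1 < L) :
    (finRotate L i : ℕ) = i + 1 := by
  obtain ⟨k, rfl⟩ : ∃ k, L = k + 1 := ⟨L - 1, by omega⟩
  exact coe_finRotate_of_ne_last (by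
    intro h
    rw [h] at hi
    simp at hi)

/-- The same surface estimate with range one: only bonds near the ends of the two segments are
rearranged. -/
theorem chainLine_append {lam : ℝ} (hl0 : 0 ≤ lam) (hl1 : lam ≤ 1) {m n : ℕ}
    (τ : Fin (m + n) → ℝ) (hτ : ∀ x, |τ x| ≤ 1) :
    |chainLine lam (m + n) τ - chainLine lam m (fun x => τ (Fin.castAdd n x)) -
      chainLine lam n (fun x => τ (Fin.natAdd m x))| ≤ 8 := by
  have hb : ∀ (L : ℕ) (τ : Fin L → ℝ), (∀ x, |τ x| ≤ 1) → ∀ i, |τ i * τ (finRotate L i)| ≤ 1 :=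
    fun L τ hτ i => by
      rw [abs_mul]
      exact mul_le_one₀ (hτ _) (abs_nonneg _) (hτ _)
  have h1 : ∑ x : Fin m, |τ (Fin.castAdd n x) * τ (finRotate (m + n) (Fin.castAdd n x)) -
      τ (Fin.castAdd n x) * τ (Fin.castAdd n (finRotate m x))| ≤ 2 * (1 : ℕ) * 2 := by
    refine sum_le_of_boundary (by norm_num) ?_ ?_
    · intro x _ hx
      rw [abs_nonpos_iff, sub_eq_zero]
      congr 2
      ext
      rw [val_finRotate_of_lt _ (by simp only [Fin.val_castAdd]; omega), Fin.val_castAdd,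
        Fin.val_castAdd, val_finRotate_of_lt _ hx]
    · intro x
      refine (abs_sub _ _).trans ?_
      linarith [hb _ τ hτ (Fin.castAdd n x), hb _ (fun x => τ (Fin.castAdd n x)) (fun x => hτ _) x]
  have h2 : ∑ x : Fin n, |τ (Fin.natAdd m x) * τ (finRotate (m + n) (Fin.natAdd m x)) -
      τ (Fin.natAdd m x) * τ (Fin.natAdd m (finRotate n x))| ≤ 2 * (1 : ℕ) * 2 := by
    refine sum_le_of_boundary (by norm_num) ?_ ?_
    · intro x _ hx
      rw [abs_nonpos_iff, sub_eq_zero]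
      congr 2
      ext
      rw [val_finRotate_of_lt _ (by simp only [Fin.val_natAdd]; omega), Fin.val_natAdd,
        Fin.val_natAdd, val_finRotate_of_lt _ hx]
      omega
    · intro x
      refine (abs_sub _ _).trans ?_
      linarith [hb _ τ hτ (Fin.natAdd m x), hb _ (fun x => τ (Fin.natAdd m x)) (fun x => hτ _) x]
  have h3 : chainLine lam (m + n) τ - chainLine lam m (fun x => τ (Fin.castAdd n x)) -
      chainLine lam n (fun x => τ (Fin.natAdd m x)) = lam * (
      ∑ x : Fin m, (τ (Fin.castAdd n x) * τ (finRotate (m + n) (Fin.castAdd n x)) -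
        τ (Fin.castAdd n x) * τ (Fin.castAdd n (finRotate m x))) +
      ∑ x : Fin n, (τ (Fin.natAdd m x) * τ (finRotate (m + n) (Fin.natAdd m x)) -
        τ (Fin.natAdd m x) * τ (Fin.natAdd m (finRotate n x)))) := by
    unfold chainLine
    rw [Fin.sum_univ_add, Finset.sum_sub_distrib, Finset.sum_sub_distrib]
    ring
  rw [h3, abs_mul, abs_of_nonneg hl0]
  refine (mul_le_of_le_one_left (abs_nonneg _) hl1).trans ?_
  have h4 := (abs_add_le _ _).trans (add_le_add ((Finset.abs_sum_le_sum_abs _ _).trans h1)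
    ((Finset.abs_sum_le_sum_abs _ _).trans h2))
  norm_num at h4 ⊢
  exact h4

/-! ### Logarithms of partition functions -/

/-- The logarithm of a finite sum of exponentials. -/
noncomputable def logSumExp {ι : Type*} [Fintype ι] (f : ι → ℝ) : ℝ := Real.log (∑ i, Real.exp (f i))

section LogSumExp

variable {ι κ : Type*} [Fintype ι] [Fintype κ]

theorem sum_exp_pos [Nonempty ι] (f : ι → ℝ) : 0 < ∑ i, Real.exp (f i) :=
  Finset.sum_pos (fun _ _ => Real.exp_pos _) Finset.univ_nonempty

theorem exp_logSumExp [Nonempty ι] (f : ι → ℝ) :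
    Real.exp (logSumExp f) = ∑ i, Real.exp (f i) := Real.exp_log (sum_exp_pos f)

theorem logSumExp_le_add [Nonempty ι] {f g : ι → ℝ} {C : ℝ} (h : ∀ i, f i ≤ g i + C) :
    logSumExp f ≤ logSumExp g + C := by
  rw [← Real.exp_le_exp, Real.exp_add, exp_logSumExp, exp_logSumExp, Finset.sum_mul]
  refine Finset.sum_le_sum fun i _ => ?_
  rw [← Real.exp_add]
  exact Real.exp_le_exp.mpr (h i)

theorem abs_logSumExp_sub_le [Nonempty ι] {f g : ι → ℝ} {C : ℝ} (h : ∀ i, |f i - g i| ≤ C) :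
    |logSumExp f - logSumExp g| ≤ C := by
  rw [abs_le]
  constructor
  · linarith [logSumExp_le_add (C := C) fun i => (by linarith [(abs_le.mp (h i)).1] : g i ≤ f i + C)]
  · linarith [logSumExp_le_add (C := C) fun i => (by linarith [(abs_le.mp (h i)).2] : f i ≤ g i + C)]

theorem logSumExp_comp_equiv (e : κ ≃ ι) (f : ι → ℝ) :
    logSumExp (fun k => f (e k)) = logSumExp f := by
  unfold logSumExp
  rw [e.sum_comp (fun i => Real.exp (f i))]

theorem logSumExp_add_prod [Nonempty ι] [Nonempty κ] (f : ι → ℝ) (g : κ → ℝ) :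
    logSumExp (fun p : ι × κ => f p.1 + g p.2) = logSumExp f + logSumExp g := by
  rw [← Real.exp_eq_exp, Real.exp_add, exp_logSumExp, exp_logSumExp, exp_logSumExp,
    Fintype.sum_prod_type, Finset.sum_mul_sum]
  simp_rw [Real.exp_add]

theorem logSumExp_pi [DecidableEq ι] [Nonempty κ] (f : ι → κ → ℝ) :
    logSumExp (fun s : ι → κ => ∑ i, f i (s i)) = ∑ i, logSumExp (f i) := by
  rw [← Real.exp_eq_exp, Real.exp_sum, exp_logSumExp]
  simp_rw [exp_logSumExp, Real.exp_sum]
  rw [Finset.prod_univ_sum, Fintype.piFinset_univ]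

theorem abs_logSumExp_le [Nonempty ι] {f : ι → ℝ} {C : ℝ} (h : ∀ i, |f i| ≤ C) :
    |logSumExp f| ≤ Real.log (Fintype.card ι) + C := by
  have h0 : |logSumExp f - logSumExp (fun _ : ι => (0 : ℝ))| ≤ C :=
    abs_logSumExp_sub_le fun i => by simpa using h i
  have h1 : logSumExp (fun _ : ι => (0 : ℝ)) = Real.log (Fintype.card ι) := by
    simp [logSumExp]
  have h2 : 0 ≤ Real.log (Fintype.card ι) :=
    Real.log_nonneg (by exact_mod_cast Fintype.card_pos)
  rw [h1] at h0
  rw [abs_le] at h0 ⊢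
  constructor <;> linarith

end LogSumExp

/-- If the energy is additive under concatenation up to `C`, so is the logarithm of the partition
function. -/
theorem abs_logSumExp_append_le {S : Type*} [Fintype S] [Nonempty S] {m n : ℕ} {C : ℝ}
    {E : (Fin (m + n) → S) → ℝ} {E₁ : (Fin m → S) → ℝ} {E₂ : (Fin n → S) → ℝ}
    (h : ∀ s, |E s - E₁ (fun x => s (Fin.castAdd n x)) - E₂ (fun x => s (Fin.natAdd m x))| ≤ C) :
    |logSumExp E - logSumExp E₁ - logSumExp E₂| ≤ C := by
  rw [sub_sub, ← logSumExp_add_prod, ← logSumExp_comp_equiv (Fin.appendEquiv m n) E]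
  refine abs_logSumExp_sub_le fun p => ?_
  have := h (Fin.appendEquiv m n p)
  simpa [Fin.appendEquiv, sub_sub] using this

/-! ### The pressure of rectangular tori -/

theorem abs_spin (s : ℤˣ) : |spin s| = 1 := by
  rcases Int.units_eq_one_or s with h | h <;> simp [spin, h]

/-- The energy, with the sign changed, on the torus of size `A × B`. -/
noncomputable def torusWeight (g : ℤ → ℝ) (lam h : ℝ) (A B : ℕ) (σ : Fin A → Fin B → ℤˣ) : ℝ :=
  ∑ i, kacLine g A (fun x => spin (σ x i)) + ∑ x, chainLine lam B (fun i => spin (σ x i)) +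
    h * ∑ x, ∑ i, spin (σ x i)

/-- The logarithm of the partition function on the torus of size `A × B`. -/
noncomputable def torusPressure (g : ℤ → ℝ) (lam h : ℝ) (A B : ℕ) : ℝ :=
  logSumExp (torusWeight g lam h A B)

section Torus

variable {g : ℤ → ℝ} {R : ℕ} {lam h : ℝ}

/-- The vertical and field energies are sums over columns and split exactly; the only error is that
of the Kac energy in each of the `B` layers. -/
theorem torusPressure_append_left (hg : IsFiniteRange g R) (m n B : ℕ) :
    |torusPressure g lam h (m + n) B - torusPressure g lam h m B - torusPressure g lam h n B| ≤
      B * (4 * R * ∑' u, g u) := by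
  refine abs_logSumExp_append_le fun σ => ?_
  have key : torusWeight g lam h (m + n) B σ -
      torusWeight g lam h m B (fun x => σ (Fin.castAdd n x)) -
      torusWeight g lam h n B (fun x => σ (Fin.natAdd m x)) =
      ∑ i : Fin B, (kacLine g (m + n) (fun x => spin (σ x i)) -
        kacLine g m (fun x => spin (σ (Fin.castAdd n x) i)) -
        kacLine g n (fun x => spin (σ (Fin.natAdd m x) i))) := by
    unfold torusWeight
    rw [Finset.sum_sub_distrib, Finset.sum_sub_distrib, Fin.sum_univ_add, Fin.sum_univ_add]
    ring
  rw [key]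
  refine (Finset.abs_sum_le_sum_abs _ _).trans ?_
  have := Finset.sum_le_sum fun i (_ : i ∈ (Finset.univ : Finset (Fin B))) =>
    kacLine_append hg (fun x => spin (σ x i)) (fun x => (abs_spin _).le)
  simpa using this

/-- Here the Kac and field energies split exactly over layers, and the error comes from the `A`
vertical chains. -/
theorem torusPressure_append_right (hl0 : 0 ≤ lam) (hl1 : lam ≤ 1) (A m n : ℕ) :
    |torusPressure g lam h A (m + n) - torusPressure g lam h A m - torusPressure g lam h A n| ≤
      A * 8 := by
  -- Configurations are transposed so that the index being concatenated becomes the outer one.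
  have hsw : ∀ B, torusPressure g lam h A B =
      logSumExp (fun s : Fin B → Fin A → ℤˣ => torusWeight g lam h A B (fun x i => s i x)) :=
    fun B => (logSumExp_comp_equiv (Equiv.piComm fun (_ : Fin B) (_ : Fin A) => ℤˣ)
      (torusWeight g lam h A B)).symm
  rw [hsw, hsw, hsw]
  refine abs_logSumExp_append_le fun σ => ?_
  have key : torusWeight g lam h A (m + n) (fun x i => σ i x) -
      torusWeight g lam h A m (fun x i => σ (Fin.castAdd n i) x) -
      torusWeight g lam h A n (fun x i => σ (Fin.natAdd m i) x) =
      ∑ x : Fin A, (chainLine lam (m + n) (fun i => spin (σ i x)) -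
        chainLine lam m (fun i => spin (σ (Fin.castAdd n i) x)) -
        chainLine lam n (fun i => spin (σ (Fin.natAdd m i) x))) := by
    unfold torusWeight
    rw [Finset.sum_sub_distrib, Finset.sum_sub_distrib, Fin.sum_univ_add]
    simp_rw [Fin.sum_univ_add]
    rw [Finset.sum_add_distrib]
    ring
  rw [key]
  refine (Finset.abs_sum_le_sum_abs _ _).trans ?_
  have := Finset.sum_le_sum fun x (_ : x ∈ (Finset.univ : Finset (Fin A))) =>
    chainLine_append hl0 hl1 (fun i => spin (σ i x)) (fun i => (abs_spin _).le)
  simpa using this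

theorem abs_torusPressure_le (hg : IsFiniteRange g R) (hl0 : 0 ≤ lam) (hl1 : lam ≤ 1) (A B : ℕ) :
    |torusPressure g lam h A B| ≤ (Real.log 2 + ∑' u, g u + 1 + |h|) * (A * B) := by
  have h1 : ∀ σ, |torusWeight g lam h A B σ| ≤ (∑' u, g u + 1 + |h|) * (A * B) := by
    intro σ
    have e1 : |∑ i : Fin B, kacLine g A (fun x => spin (σ x i))| ≤ B * (A * ∑' u, g u) := by
      refine (Finset.abs_sum_le_sum_abs _ _).trans ?_
      simpa using Finset.sum_le_sum fun i (_ : i ∈ (Finset.univ : Finset (Fin B))) =>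
        abs_kacLine_le hg (fun x => spin (σ x i)) (fun x => (abs_spin _).le)
    have e2 : |∑ x : Fin A, chainLine lam B (fun i => spin (σ x i))| ≤ A * B := by
      refine (Finset.abs_sum_le_sum_abs _ _).trans ?_
      simpa using Finset.sum_le_sum fun x (_ : x ∈ (Finset.univ : Finset (Fin A))) =>
        abs_chainLine_le hl0 hl1 (fun i => spin (σ x i)) (fun x => (abs_spin _).le)
    have e3 : |h * ∑ x : Fin A, ∑ i : Fin B, spin (σ x i)| ≤ |h| * (A * B) := by
      rw [abs_mul]
      refine mul_le_mul_of_nonneg_left ?_ (abs_nonneg h)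
      refine (Finset.abs_sum_le_sum_abs _ _).trans ?_
      have : ∀ x : Fin A, |∑ i : Fin B, spin (σ x i)| ≤ B := fun x =>
        (Finset.abs_sum_le_sum_abs _ _).trans (by simp [abs_spin])
      simpa using Finset.sum_le_sum fun x (_ : x ∈ (Finset.univ : Finset (Fin A))) => this x
    unfold torusWeight
    refine (abs_add_three _ _ _).trans ?_
    linarith
  refine (abs_logSumExp_le h1).trans (le_of_eq ?_)
  simp only [Fintype.card_pi, Fintype.card_units_int, Finset.prod_const, Finset.card_univ,
    Fintype.card_fin]
  push_cast
  rw [← pow_mul, Real.log_pow]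
  push_cast
  ring

/-! ### Convergence of almost additive functions of two side lengths -/

/-- A sequence which is additive up to a constant, at a multiple of `n` plus a remainder. -/
theorem abs_sub_mul_le_of_almost_additive {f : ℕ → ℝ} {C D : ℝ}
    (h : ∀ m n, |f (m + n) - f m - f n| ≤ C) (hD : ∀ n, |f n| ≤ D * n) (q n r : ℕ) :
    |f (n * q + r) - q * f n| ≤ C * q + D * r := by
  induction q with
  | zero => simpa using hD r
  | succ q ih =>
    have h1 := h n (n * q + r)
    have h2 : n * (q + 1) + r = n + (n * q + r) := by ring
    rw [h2]
    have h3 : f (n + (n * q + r)) - ((q + 1 : ℕ) : ℝ) * f n =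
      (f (n + (n * q + r)) - f n - f (n * q + r)) + (f (n * q + r) - q * f n) := by
      push_cast; ring
    rw [h3]
    refine (abs_add_le _ _).trans ?_
    push_cast
    linarith

/-- With `L = n q + r`, the `L × L` torus is compared with `q²` copies of the `n × n` torus, one
direction at a time; the strips of width `r < n` are controlled by the volume bound. -/
theorem abs_div_sq_sub_le {f : ℕ → ℕ → ℝ} {C : ℝ} (hC : 0 ≤ C)
    (h1 : ∀ m n B, |f (m + n) B - f m B - f n B| ≤ C * B)
    (h2 : ∀ A m n, |f A (m + n) - f A m - f A n| ≤ C * A)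
    (h3 : ∀ A B, |f A B| ≤ C * (A * B)) {n L : ℕ} (hn : 0 < n) (hL : 0 < L) :
    |1 / (L : ℝ) ^ 2 * f L L - 1 / (n : ℝ) ^ 2 * f n n| ≤ 2 * C / n + 4 * C * n / L := by
  obtain ⟨q, r, hr, rfl⟩ : ∃ q r, r < n ∧ L = n * q + r :=
    ⟨L / n, L % n, Nat.mod_lt _ hn, (Nat.div_add_mod L n).symm⟩
  set L := n * q + r with hLdef
  have hnq : (n : ℝ) * q ≤ L := by rw [hLdef]; push_cast; linarith [(Nat.cast_nonneg r : (0:ℝ) ≤ r)]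
  have hLr : (L : ℝ) = n * q + r := by rw [hLdef]; push_cast; ring
  have hrn : (r : ℝ) ≤ n := by exact_mod_cast hr.le
  have hn' : (0 : ℝ) < n := by exact_mod_cast hn
  have hL' : (0 : ℝ) < L := by exact_mod_cast hL
  have hq : (0 : ℝ) ≤ q := Nat.cast_nonneg q
  have hr0 : (0 : ℝ) ≤ r := Nat.cast_nonneg r
  have a1 : |f L L - q * f n L| ≤ C * L * q + C * L * r := by
    have := abs_sub_mul_le_of_almost_additive (f := fun m => f m L) (C := C * L) (D := C * L)
      (fun m n => h1 m n L) (fun m => (h3 m L).trans (by linarith)) q n r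
    exact this
  have a2 : |f n L - q * f n n| ≤ C * n * q + C * n * r := by
    have := abs_sub_mul_le_of_almost_additive (f := fun m => f n m) (C := C * n) (D := C * n)
      (fun m k => h2 n m k) (fun m => (h3 n m).trans (by linarith)) q n r
    exact this
  have a3 := h3 n n
  -- The last term corrects the normalization: `L² - (n q)² = r (n q + L)`.
  have key : 1 / (L : ℝ) ^ 2 * f L L - 1 / (n : ℝ) ^ 2 * f n n =
      1 / (L : ℝ) ^ 2 * ((f L L - q * f n L) + q * (f n L - q * f n n) -
        r * (n * q + L) / (n : ℝ) ^ 2 * f n n) := by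
    have : (r : ℝ) = L - n * q := by linarith
    rw [this]
    field_simp
    ring
  have b1 : |(f L L - q * f n L) + q * (f n L - q * f n n) -
        r * (n * q + L) / (n : ℝ) ^ 2 * f n n| ≤
      (C * L * q + C * L * r) + q * (C * n * q + C * n * r) + r * (n * q + L) * C := by
    refine (abs_sub _ _).trans (add_le_add ((abs_add_le _ _).trans (add_le_add a1 ?_)) ?_)
    · rw [abs_mul, abs_of_nonneg hq]
      exact mul_le_mul_of_nonneg_left a2 hq
    · rw [abs_mul, abs_of_nonneg (by positivity), div_mul_eq_mul_div, mul_div_assoc]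
      refine mul_le_mul_of_nonneg_left ?_ (by positivity)
      rw [div_le_iff₀ (by positivity)]
      linarith
  have b2 : (C * L * q + C * L * r) + q * (C * n * q + C * n * r) + r * (n * q + L) * C ≤
      C * (2 * L * q + 4 * n * L) := by
    have c1 : q * (n * q) ≤ q * (L : ℝ) := mul_le_mul_of_nonneg_left hnq hq
    have c2 : (r : ℝ) * L ≤ n * L := mul_le_mul_of_nonneg_right hrn hL'.le
    have c3 : (n * q) * r ≤ (L : ℝ) * n := mul_le_mul hnq hrn hr0 hL'.le
    calc _ = C * (L * q + q * (n * q) + 2 * (r * L) + 2 * (n * q * r)) := by ring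
      _ ≤ _ := mul_le_mul_of_nonneg_left (by linarith) hC
  rw [key, abs_mul, abs_of_nonneg (by positivity)]
  calc _ ≤ 1 / (L : ℝ) ^ 2 * (C * (2 * L * q + 4 * n * L)) :=
        mul_le_mul_of_nonneg_left (b1.trans b2) (by positivity)
    _ = 2 * C * (q / L) + 4 * C * n / L := by field_simp
    _ ≤ 2 * C * (1 / n) + 4 * C * n / L := by
        have : (q : ℝ) / L ≤ 1 / n := by
          rw [div_le_div_iff₀ hL' hn']
          linarith
        gcongr
    _ = _ := by ring

/-- Cauchy criterion: first `n` is chosen to make `2 C / n` small, then `L` large compared with `n`.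
The two-sided errors replace any subadditivity. -/
theorem exists_tendsto_div_sq {f : ℕ → ℕ → ℝ} {C : ℝ} (hC : 0 ≤ C)
    (h1 : ∀ m n B, |f (m + n) B - f m B - f n B| ≤ C * B)
    (h2 : ∀ A m n, |f A (m + n) - f A m - f A n| ≤ C * A)
    (h3 : ∀ A B, |f A B| ≤ C * (A * B)) :
    ∃ P, Tendsto (fun L : ℕ => 1 / (L : ℝ) ^ 2 * f L L) atTop (𝓝 P) := by
  refine cauchySeq_tendsto_of_complete (Metric.cauchySeq_iff'.mpr fun ε hε => ?_)
  have t1 : Tendsto (fun n : ℕ => 2 * C / (n : ℝ)) atTop (𝓝 0) :=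
    tendsto_const_div_atTop_nhds_zero_nat _
  obtain ⟨n, hn1, hn⟩ := ((t1.eventually (gt_mem_nhds (by linarith : (0 : ℝ) < ε / 8))).and
    (eventually_gt_atTop 0)).exists
  have t2 : Tendsto (fun L : ℕ => 4 * C * n / (L : ℝ)) atTop (𝓝 0) :=
    tendsto_const_div_atTop_nhds_zero_nat _
  obtain ⟨N, hN⟩ := eventually_atTop.mp
    ((t2.eventually (gt_mem_nhds (by linarith : (0 : ℝ) < ε / 8))).and (eventually_gt_atTop 0))
  have hb : ∀ L ≥ N, |1 / (L : ℝ) ^ 2 * f L L - 1 / (n : ℝ) ^ 2 * f n n| ≤ ε / 4 := fun L hL =>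
    (abs_div_sq_sub_le hC h1 h2 h3 hn (hN L hL).2).trans (by linarith [(hN L hL).1])
  refine ⟨N, fun L hL => ?_⟩
  rw [Real.dist_eq]
  have e1 := abs_le.mp (hb L hL)
  have e2 := abs_le.mp (hb N le_rfl)
  rw [abs_lt]
  constructor <;> linarith [e1.1, e1.2, e2.1, e2.2]

/-- The pressure has a thermodynamic limit. -/
theorem exists_tendsto_torusPressure (hg : IsFiniteRange g R) (hl0 : 0 ≤ lam) (hl1 : lam ≤ 1) :
    ∃ P, Tendsto (fun L : ℕ => 1 / (L : ℝ) ^ 2 * torusPressure g lam h L L) atTop (𝓝 P) := by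
  have hG := hg.tsum_nonneg
  have hlog := Real.log_nonneg (by norm_num : (1 : ℝ) ≤ 2)
  have hR : 0 ≤ 4 * (R : ℝ) * ∑' u, g u := by positivity
  refine exists_tendsto_div_sq
    (C := 4 * R * ∑' u, g u + 8 + (Real.log 2 + ∑' u, g u + 1 + |h|)) (by positivity)
    (fun m n B => ?_) (fun A m n => ?_) (fun A B => ?_)
  · refine (torusPressure_append_left hg m n B).trans ?_
    rw [mul_comm]
    refine mul_le_mul_of_nonneg_right ?_ (by positivity)
    linarith [abs_nonneg h]
  · refine (torusPressure_append_right hl0 hl1 A m n).trans ?_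
    rw [mul_comm]
    refine mul_le_mul_of_nonneg_right ?_ (by positivity)
    linarith [abs_nonneg h]
  · refine (abs_torusPressure_le hg hl0 hl1 A B).trans ?_
    refine mul_le_mul_of_nonneg_right ?_ (by positivity)
    linarith [abs_nonneg h]

end Torus

/-! ### Gibbs averages -/

/-- The average of `f` with respect to the probability weights proportional to `exp E`. -/
noncomputable def gibbs {ι : Type*} [Fintype ι] (E f : ι → ℝ) : ℝ :=
  (∑ i, Real.exp (E i) * f i) / ∑ i, Real.exp (E i)

section Gibbs

variable {ι κ : Type*} [Fintype ι] [Fintype κ]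

theorem gibbs_add (E f f' : ι → ℝ) : gibbs E (fun i => f i + f' i) = gibbs E f + gibbs E f' := by
  simp only [gibbs, mul_add, Finset.sum_add_distrib, add_div]

theorem gibbs_mul (E f : ι → ℝ) (c : ℝ) : gibbs E (fun i => c * f i) = c * gibbs E f := by
  simp only [gibbs, mul_left_comm _ c, ← Finset.mul_sum, mul_div_assoc]

theorem gibbs_sum {κ : Type*} (E : ι → ℝ) (s : Finset κ) (f : κ → ι → ℝ) :
    gibbs E (fun i => ∑ k ∈ s, f k i) = ∑ k ∈ s, gibbs E (f k) := by
  simp only [gibbs, Finset.mul_sum]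
  rw [Finset.sum_comm, Finset.sum_div]

theorem gibbs_const [Nonempty ι] (E : ι → ℝ) (c : ℝ) : gibbs E (fun _ => c) = c := by
  rw [gibbs, ← Finset.sum_mul, mul_div_assoc, mul_comm, div_mul_cancel₀ _ (sum_exp_pos E).ne']

theorem gibbs_mono [Nonempty ι] (E : ι → ℝ) {f f' : ι → ℝ} (h : ∀ i, f i ≤ f' i) :
    gibbs E f ≤ gibbs E f' :=
  div_le_div_of_nonneg_right
    (Finset.sum_le_sum fun i _ => mul_le_mul_of_nonneg_left (h i) (Real.exp_pos _).le)
    (sum_exp_pos E).le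

theorem abs_gibbs_le [Nonempty ι] (E : ι → ℝ) {f : ι → ℝ} {c : ℝ} (h : ∀ i, |f i| ≤ c) :
    |gibbs E f| ≤ c := by
  rw [abs_le]
  constructor
  · rw [← gibbs_const E (-c)]
    exact gibbs_mono E fun i => (abs_le.mp (h i)).1
  · rw [← gibbs_const E c]
    exact gibbs_mono E fun i => (abs_le.mp (h i)).2

/-- The Gibbs variational principle. -/
theorem logSumExp_add_gibbs_le [Nonempty ι] (E E₀ : ι → ℝ) :
    logSumExp E₀ + gibbs E₀ (fun i => E i - E₀ i) ≤ logSumExp E := by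
  set c := gibbs E₀ (fun i => E i - E₀ i) with hc
  have hZ := sum_exp_pos E₀
  rw [← Real.exp_le_exp, Real.exp_add, exp_logSumExp, exp_logSumExp]
  have h1 : ∑ i, Real.exp (E₀ i) * (E i - E₀ i) = c * ∑ i, Real.exp (E₀ i) := by
    rw [hc, gibbs, div_mul_cancel₀ _ hZ.ne']
  -- Jensen's inequality by the tangent line `1 + t ≤ exp t` at `t = E i - E₀ i - c`, whose average
  -- under the weights `exp E₀` is zero by the choice of `c`.
  calc (∑ i, Real.exp (E₀ i)) * Real.exp c
      = Real.exp c * ((1 - c) * ∑ i, Real.exp (E₀ i) +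
          ∑ i, Real.exp (E₀ i) * (E i - E₀ i)) := by rw [h1]; ring
    _ = ∑ i, Real.exp (E₀ i) * Real.exp c * ((E i - E₀ i - c) + 1) := by
        rw [Finset.mul_sum, ← Finset.sum_add_distrib, Finset.mul_sum]
        exact Finset.sum_congr rfl fun i _ => by ring
    _ ≤ ∑ i, Real.exp (E i) := by
        refine Finset.sum_le_sum fun i _ => ?_
        calc _ ≤ Real.exp (E₀ i) * Real.exp c * Real.exp (E i - E₀ i - c) :=
              mul_le_mul_of_nonneg_left (Real.add_one_le_exp _) (by positivity)
          _ = Real.exp (E i) := by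
              rw [← Real.exp_add, ← Real.exp_add]
              congr 1
              ring

theorem gibbs_pi [DecidableEq ι] (E f : ι → κ → ℝ) :
    gibbs (fun s : ι → κ => ∑ i, E i (s i)) (fun s => ∏ i, f i (s i)) =
      ∏ i, gibbs (E i) (f i) := by
  simp only [gibbs, Real.exp_sum, ← Finset.prod_mul_distrib]
  rw [Finset.prod_div_distrib, Finset.prod_univ_sum, Finset.prod_univ_sum,
    Fintype.piFinset_univ]

theorem gibbs_pi_apply [DecidableEq ι] [Nonempty κ] (E : ι → κ → ℝ) (u : κ → ℝ) (x : ι) :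
    gibbs (fun s : ι → κ => ∑ i, E i (s i)) (fun s => u (s x)) = gibbs (E x) u := by
  -- A function of one coordinate is a product with the factor `1` at all the others.
  have h := gibbs_pi E (fun i => if i = x then u else fun _ => 1)
  rw [Fintype.prod_eq_single x] at h
  · rw [if_pos rfl] at h
    rw [← h]
    congr 1
    funext s
    rw [Fintype.prod_eq_single x]
    · simp
    · intro z hz
      simp [hz]
  · intro z hz
    simp only [hz, if_false]
    exact gibbs_const _ _

theorem gibbs_pi_apply_mul_apply [DecidableEq ι] [Nonempty κ] (E : ι → κ → ℝ) (u v : κ → ℝ)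
    {x y : ι} (hxy : x ≠ y) :
    gibbs (fun s : ι → κ => ∑ i, E i (s i)) (fun s => u (s x) * v (s y)) =
      gibbs (E x) u * gibbs (E y) v := by
  have h := gibbs_pi E (fun i => if i = x then u else if i = y then v else fun _ => 1)
  rw [Fintype.prod_eq_mul x y hxy] at h
  · rw [if_pos rfl, if_neg hxy.symm, if_pos rfl] at h
    rw [← h]
    congr 1
    funext s
    rw [Fintype.prod_eq_mul x y hxy]
    · simp [hxy.symm]
    · rintro z ⟨hz, hz'⟩
      simp [hz, hz']
  · rintro z ⟨hz, hz'⟩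
    simp only [hz, hz', if_false]
    exact gibbs_const _ _

end Gibbs

/-! ### The pressure of one column -/

/-- The energy, with the sign changed, of a column of spins in the field `b`. -/
noncomputable def columnWeight (lam : ℝ) (L : ℕ) (b : Fin L → ℝ) (s : Fin L → ℤˣ) : ℝ :=
  chainLine lam L (fun i => spin (s i)) + ∑ i, b i * spin (s i)

/-- The logarithm of the partition function of a column in the field `h + a`, minus the cost
`∑ aᵢ² / 2` of the auxiliary field `a`. -/
noncomputable def meanFieldValue (lam h : ℝ) (L : ℕ) (a : Fin L → ℝ) : ℝ :=
  logSumExp (columnWeight lam L (fun i => h + a i)) - 1 / 2 * ∑ i, a i ^ 2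

/-- The supremum of `meanFieldValue` over the auxiliary fields with values in `[-1, 1]`. -/
noncomputable def meanFieldPressure (lam h : ℝ) (L : ℕ) : ℝ :=
  sSup (meanFieldValue lam h L '' Set.Icc (-1) 1)

theorem continuous_meanFieldValue (lam h : ℝ) (L : ℕ) : Continuous (meanFieldValue lam h L) := by
  unfold meanFieldValue logSumExp columnWeight
  refine Continuous.sub (Continuous.log (by fun_prop) fun a => (sum_exp_pos _).ne') (by fun_prop)

theorem meanFieldValue_le (lam h : ℝ) {L : ℕ} {a : Fin L → ℝ} (ha : ∀ i, |a i| ≤ 1) :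
    meanFieldValue lam h L a ≤ meanFieldPressure lam h L :=
  le_csSup (isCompact_Icc.bddAbove_image (continuous_meanFieldValue lam h L).continuousOn)
    ⟨a, ⟨fun i => (abs_le.mp (ha i)).1, fun i => (abs_le.mp (ha i)).2⟩, rfl⟩

theorem meanFieldPressure_le {lam h : ℝ} {L : ℕ} {c : ℝ}
    (hc : ∀ a : Fin L → ℝ, (∀ i, |a i| ≤ 1) → meanFieldValue lam h L a ≤ c) :
    meanFieldPressure lam h L ≤ c := by
  refine csSup_le ⟨_, 0, ⟨?_, ?_⟩, rfl⟩ ?_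
  · intro i; simp
  · intro i; simp
  · rintro _ ⟨a, ha, rfl⟩
    exact hc a fun i => abs_le.mpr ⟨ha.1 i, ha.2 i⟩

/-- Independent columns in auxiliary fields. -/
theorem logSumExp_columns (lam h : ℝ) (A B : ℕ) (a : Fin A → Fin B → ℝ) :
    logSumExp (fun σ : Fin A → Fin B → ℤˣ =>
      ∑ x, columnWeight lam B (fun i => h + a x i) (σ x) - 1 / 2 * ∑ x, ∑ i, a x i ^ 2) =
      ∑ x, meanFieldValue lam h B (a x) := by
  have h1 := logSumExp_pi (fun x : Fin A => fun s : Fin B → ℤˣ =>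
    columnWeight lam B (fun i => h + a x i) s - 1 / 2 * ∑ i, a x i ^ 2)
  have h2 : ∀ x, logSumExp (fun s : Fin B → ℤˣ =>
      columnWeight lam B (fun i => h + a x i) s - 1 / 2 * ∑ i, a x i ^ 2) =
      meanFieldValue lam h B (a x) := fun x => by
    rw [meanFieldValue]
    refine le_antisymm ?_ ?_
    · rw [sub_eq_add_neg]
      exact logSumExp_le_add fun s => by simp [sub_eq_add_neg]
    · rw [sub_le_iff_le_add]
      exact logSumExp_le_add fun s => by simp
  simp_rw [h2] at h1
  rw [← h1]
  congr 1
  funext σ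
  rw [Finset.sum_sub_distrib, Finset.mul_sum]

theorem sum_chainLine_add_field (lam h : ℝ) (A B : ℕ) (a : Fin A → Fin B → ℝ)
    (σ : Fin A → Fin B → ℤˣ) :
    ∑ x, columnWeight lam B (fun i => h + a x i) (σ x) =
      ∑ x, chainLine lam B (fun i => spin (σ x i)) + h * ∑ x, ∑ i, spin (σ x i) +
      ∑ x, ∑ i, a x i * spin (σ x i) := by
  simp only [columnWeight, add_mul, Finset.sum_add_distrib, Finset.mul_sum]
  ring

/-- The mean field lower bound on the pressure. -/
theorem meanFieldValue_le_torusPressure {g : ℤ → ℝ} {R : ℕ} (hg : IsFiniteRange g R)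
    (hsum : ∑' u, g u = 1) (lam h : ℝ) {A : ℕ} (hA : 0 < A) (B : ℕ) (a : Fin B → ℝ) :
    A * meanFieldValue lam h B a - A * B * periodize g A 0 / 2 ≤ torusPressure g lam h A B := by
  -- The trial measure: independent columns, all in the same field `h + a`. Distinct columns are
  -- uncorrelated, so the mean Kac energy depends only on the layer means `m i`.
  set W := columnWeight lam B (fun i => h + a i) with hW
  set E₀ : (Fin A → Fin B → ℤˣ) → ℝ := fun σ => ∑ x, W (σ x) with hE₀
  have hv := logSumExp_add_gibbs_le (torusWeight g lam h A B) E₀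
  have h1 : logSumExp E₀ = A * logSumExp W := by
    rw [hE₀, logSumExp_pi (fun _ : Fin A => W)]
    simp
  set m : Fin B → ℝ := fun i => gibbs W (fun s => spin (s i)) with hm
  have hm1 : ∀ i, |m i| ≤ 1 := fun i => abs_gibbs_le W fun s => (abs_spin _).le
  have hp0 := periodize_nonneg hg.nonneg A 0
  have h2 : (fun σ => torusWeight g lam h A B σ - E₀ σ) = fun σ =>
      (∑ i, 1 / 2 * ∑ x : Fin A, ∑ y : Fin A,
        (if y = x then 0 else periodize g A (((y : ℕ) : ℤ) - ((x : ℕ) : ℤ))) *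
          (spin (σ x i) * spin (σ y i))) + ∑ x : Fin A, ∑ i, (- a i) * spin (σ x i) := by
    funext σ
    have e := sum_chainLine_add_field lam h A B (fun _ => a) σ
    have e' : E₀ σ = ∑ x, columnWeight lam B (fun i => h + a i) (σ x) := rfl
    rw [e', e]
    unfold torusWeight kacLine
    simp only [ite_mul, zero_mul, mul_assoc, neg_mul, Finset.sum_neg_distrib]
    ring
  have h3 : gibbs E₀ (fun σ => torusWeight g lam h A B σ - E₀ σ) =
      (∑ i, 1 / 2 * ∑ x : Fin A, ∑ y : Fin A,
        (if y = x then 0 else periodize g A (((y : ℕ) : ℤ) - ((x : ℕ) : ℤ))) *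
          (m i * m i)) + ∑ x : Fin A, ∑ i, (- a i) * m i := by
    rw [h2, gibbs_add]
    simp_rw [gibbs_sum, gibbs_mul, gibbs_sum, gibbs_mul]
    congr 1
    · refine Finset.sum_congr rfl fun i _ => ?_
      congr 1
      refine Finset.sum_congr rfl fun x _ => Finset.sum_congr rfl fun y _ => ?_
      by_cases hxy : y = x
      · simp [hxy]
      · rw [gibbs_pi_apply_mul_apply (fun _ : Fin A => W) (fun s => spin (s i))
          (fun s => spin (s i)) (Ne.symm hxy)]
    · refine Finset.sum_congr rfl fun x _ => Finset.sum_congr rfl fun i _ => ?_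
      rw [gibbs_pi_apply (fun _ : Fin A => W) (fun s => spin (s i))]
  -- The hamiltonian omits `y = x`, so each row has mass one minus the diagonal entry.
  have h4 : ∀ x : Fin A, ∑ y : Fin A,
      (if y = x then 0 else periodize g A (((y : ℕ) : ℤ) - ((x : ℕ) : ℤ))) =
      1 - periodize g A 0 := by
    intro x
    rw [← hsum, ← sum_periodize hg.summable hA ((x : ℕ) : ℤ)]
    rw [eq_sub_iff_add_eq, ← Finset.sum_erase_add _ _ (Finset.mem_univ x),
      ← Finset.sum_erase_add _ (fun y : Fin A => periodize g A (((y : ℕ) : ℤ) - ((x : ℕ) : ℤ)))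
        (Finset.mem_univ x)]
    rw [if_pos rfl, add_zero, sub_self]
    congr 1
    refine Finset.sum_congr rfl fun y hy => if_neg (Finset.ne_of_mem_erase hy)
  have h5 : gibbs E₀ (fun σ => torusWeight g lam h A B σ - E₀ σ) =
      ∑ i, A * (1 / 2 * ((1 - periodize g A 0) * (m i * m i)) - a i * m i) := by
    rw [h3]
    simp_rw [← Finset.sum_mul, h4]
    rw [Finset.sum_comm (s := (Finset.univ : Finset (Fin A))), ← Finset.sum_add_distrib]
    refine Finset.sum_congr rfl fun i _ => ?_
    simp only [Finset.sum_const, Finset.card_univ, Fintype.card_fin, nsmul_eq_mul]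
    ring
  -- `m² / 2 - a m ≥ -a² / 2` by `(m - a)² ≥ 0`, so `a` need not solve the mean field equation; the
  -- missing diagonal costs at most half its value since `m² ≤ 1`.
  have h6 : ∑ i : Fin B, A * (-(1 / 2 * a i ^ 2) - periodize g A 0 / 2) ≤
      ∑ i, A * (1 / 2 * ((1 - periodize g A 0) * (m i * m i)) - a i * m i) := by
    refine Finset.sum_le_sum fun i _ => mul_le_mul_of_nonneg_left ?_ (Nat.cast_nonneg A)
    have : m i * m i ≤ 1 := by
      rw [← abs_mul_abs_self]
      exact mul_le_one₀ (hm1 i) (abs_nonneg _) (hm1 i)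
    nlinarith [sq_nonneg (m i - a i), mul_le_mul_of_nonneg_left this hp0]
  rw [h1, h5] at hv
  refine le_trans (le_of_eq ?_) ((add_le_add_right h6 _).trans hv)
  rw [← Finset.mul_sum, Finset.sum_sub_distrib, meanFieldValue, Finset.sum_neg_distrib,
    ← Finset.mul_sum]
  simp only [Finset.sum_const, Finset.card_univ, Fintype.card_fin, nsmul_eq_mul]
  ring

theorem meanFieldPressure_le_torusPressure {g : ℤ → ℝ} {R : ℕ} (hg : IsFiniteRange g R)
    (hsum : ∑' u, g u = 1) (lam h : ℝ) {A : ℕ} (hA : 0 < A) (B : ℕ) :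
    A * meanFieldPressure lam h B - A * B * periodize g A 0 / 2 ≤ torusPressure g lam h A B := by
  have hA' : (0 : ℝ) < A := by exact_mod_cast hA
  have : meanFieldPressure lam h B ≤
      (torusPressure g lam h A B + A * B * periodize g A 0 / 2) / A := by
    refine meanFieldPressure_le fun a _ => ?_
    rw [le_div_iff₀ hA']
    linarith [meanFieldValue_le_torusPressure hg hsum lam h hA B a]
  rw [le_div_iff₀ hA'] at this
  linarith

/-- If the energy of each configuration is bounded by that of independent columns in one of
finitely many auxiliary fields, then so is the pressure, up to the number of fields. -/
theorem logSumExp_le_of_columns {lam h : ℝ} {A B : ℕ} (E : (Fin A → Fin B → ℤˣ) → ℝ)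
    (K : Finset (Fin A → Fin B → ℝ)) (hK : ∀ a ∈ K, ∀ x i, |a x i| ≤ 1) (C : ℝ)
    (hE : ∀ σ, ∃ a ∈ K, E σ ≤
      ∑ x, columnWeight lam B (fun i => h + a x i) (σ x) - 1 / 2 * ∑ x, ∑ i, a x i ^ 2 + C) :
    logSumExp E ≤ A * meanFieldPressure lam h B + C + Real.log K.card := by
  have hpos : 0 < (K.card : ℝ) := by
    obtain ⟨a, ha, _⟩ := hE fun _ _ => 1
    exact_mod_cast Finset.card_pos.mpr ⟨a, ha⟩
  rw [← Real.exp_le_exp, exp_logSumExp, Real.exp_add, Real.exp_log hpos]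
  set T : (Fin A → Fin B → ℝ) → (Fin A → Fin B → ℤˣ) → ℝ := fun a σ =>
    ∑ x, columnWeight lam B (fun i => h + a x i) (σ x) - 1 / 2 * ∑ x, ∑ i, a x i ^ 2 with hT
  calc ∑ σ, Real.exp (E σ) ≤ ∑ σ, ∑ a ∈ K, Real.exp (T a σ + C) := by
        refine Finset.sum_le_sum fun σ _ => ?_
        obtain ⟨a, ha, hle⟩ := hE σ
        exact (Real.exp_le_exp.mpr hle).trans
          (Finset.single_le_sum (f := fun a => Real.exp (T a σ + C))
            (fun _ _ => (Real.exp_pos _).le) ha)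
    _ = ∑ a ∈ K, Real.exp (logSumExp (T a) + C) := by
        rw [Finset.sum_comm]
        refine Finset.sum_congr rfl fun a _ => ?_
        rw [Real.exp_add, exp_logSumExp, Finset.sum_mul]
        simp_rw [Real.exp_add]
    _ ≤ ∑ a ∈ K, Real.exp (A * meanFieldPressure lam h B + C) := by
        refine Finset.sum_le_sum fun a ha => Real.exp_le_exp.mpr ?_
        refine add_le_add_left ?_ C
        rw [hT, logSumExp_columns]
        have := Finset.sum_le_sum fun x (_ : x ∈ (Finset.univ : Finset (Fin A))) =>
          meanFieldValue_le lam h (hK a ha x)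
        simpa using this
    _ = _ := by rw [Finset.sum_const, nsmul_eq_mul, mul_comm]

/-! ### Block averages -/

section BlockAverage

variable {X Q : Type*} [Fintype X] [DecidableEq Q] (c : X → Q)

/-- The number of points in the block of `x`. -/
def blockCard (x : X) : ℕ := (Finset.univ.filter fun y => c y = c x).card

/-- The average of `τ` over the block of `x`; the blocks are the fibres of `c`. -/
noncomputable def blockAverage (τ : X → ℝ) (x : X) : ℝ :=
  (blockCard c x : ℝ)⁻¹ * ∑ y ∈ Finset.univ.filter (fun y => c y = c x), τ y

variable {c}

theorem blockCard_pos (x : X) : 0 < blockCard c x := Finset.card_pos.mpr ⟨x, by simp⟩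

theorem blockCard_congr {x y : X} (h : c x = c y) : blockCard c x = blockCard c y := by
  simp only [blockCard, h]

theorem blockAverage_congr (τ : X → ℝ) {x y : X} (h : c x = c y) :
    blockAverage c τ x = blockAverage c τ y := by
  simp only [blockAverage, blockCard, h]

theorem abs_blockAverage_le {τ : X → ℝ} (hτ : ∀ x, |τ x| ≤ 1) (x : X) :
    |blockAverage c τ x| ≤ 1 := by
  have hN : (0 : ℝ) < blockCard c x := by exact_mod_cast blockCard_pos x
  unfold blockAverage
  rw [abs_mul, abs_of_pos (inv_pos.mpr hN), inv_mul_le_iff₀ hN, mul_one]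
  refine (Finset.abs_sum_le_sum_abs _ _).trans ?_
  refine (Finset.sum_le_sum fun y _ => hτ y).trans ?_
  simp [blockCard]

/-- Block averaging is self-adjoint. The fluctuation of the spins inside a block is thereby
transferred to the kernel, where it is small because the kernel varies slowly. -/
theorem sum_mul_sub_blockAverage (K τ : X → ℝ) :
    ∑ y, K y * (τ y - blockAverage c τ y) = ∑ y, (K y - blockAverage c K y) * τ y := by
  have h : ∑ y, K y * blockAverage c τ y = ∑ y, blockAverage c K y * τ y := by
    simp only [blockAverage, Finset.mul_sum, Finset.sum_mul, Finset.sum_filter]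
    rw [Finset.sum_comm]
    refine Finset.sum_congr rfl fun y _ => Finset.sum_congr rfl fun z _ => ?_
    by_cases hyz : c y = c z
    · simp only [hyz, if_true, blockCard_congr hyz]
      ring
    · simp [hyz, Ne.symm hyz]
  simp only [mul_sub, sub_mul, Finset.sum_sub_distrib, h]

theorem abs_sub_blockAverage_le {K : X → ℝ} {x : X} {d : ℝ}
    (h : ∀ z, c z = c x → |K x - K z| ≤ d) : |K x - blockAverage c K x| ≤ d := by
  have hN : (0 : ℝ) < blockCard c x := by exact_mod_cast blockCard_pos x
  have e : K x - blockAverage c K x =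
      (blockCard c x : ℝ)⁻¹ * ∑ z ∈ Finset.univ.filter (fun z => c z = c x), (K x - K z) := by
    rw [Finset.sum_sub_distrib, mul_sub, blockAverage, Finset.sum_const, nsmul_eq_mul]
    congr 1
    exact (inv_mul_cancel_left₀ hN.ne' _).symm
  rw [e, abs_mul, abs_of_pos (inv_pos.mpr hN), inv_mul_le_iff₀ hN]
  refine (Finset.abs_sum_le_sum_abs _ _).trans ?_
  refine (Finset.sum_le_sum fun z hz => h z (Finset.mem_filter.mp hz).2).trans ?_
  simp [blockCard]

/-- Block averaging is an orthogonal projection. Hence, in the auxiliary field `a` equal to the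
block average `m`, the linearized energy `∑ (a τ - a² / 2)` is exactly `∑ m² / 2`. -/
theorem sum_blockAverage_mul (τ : X → ℝ) :
    ∑ x, blockAverage c τ x * τ x = ∑ x, blockAverage c τ x ^ 2 := by
  have h := sum_mul_sub_blockAverage (c := c) (blockAverage c τ) τ
  have h0 : ∀ x, blockAverage c τ x - blockAverage c (blockAverage c τ) x = 0 := fun x =>
    abs_nonpos_iff.mp (abs_sub_blockAverage_le fun z hz => by
      rw [blockAverage_congr τ hz, sub_self, abs_zero])
  simp only [h0, zero_mul, Finset.sum_const_zero, mul_sub, Finset.sum_sub_distrib] at h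
  simp only [pow_two]
  linarith

/-- Replacing the spins by their block averages in a quadratic form with a slowly varying
kernel. -/
theorem sum_kernel_le_blockAverage {k : X → X → ℝ} (hk0 : ∀ x y, 0 ≤ k x y)
    (hks : ∀ x y, k x y = k y x) (hk1 : ∀ x, ∑ y, k x y = 1) {ε : ℝ} (D : X → X → ℝ)
    (hD : ∀ x y z, c z = c y → |k x y - k x z| ≤ D x y) (hDε : ∀ x, ∑ y, D x y ≤ ε)
    {τ : X → ℝ} (hτ : ∀ x, |τ x| ≤ 1) :
    ∑ x, ∑ y, k x y * τ x * τ y ≤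
      ∑ x, blockAverage c τ x ^ 2 + 2 * (Fintype.card X * ε) := by
  set m := blockAverage c τ with hm
  have hm1 : ∀ x, |m x| ≤ 1 := abs_blockAverage_le hτ
  have e1 : ∀ x, |∑ y, k x y * (τ y - m y)| ≤ ε := fun x => by
    rw [hm, sum_mul_sub_blockAverage]
    refine (Finset.abs_sum_le_sum_abs _ _).trans (le_trans (Finset.sum_le_sum fun y _ => ?_) (hDε x))
    rw [abs_mul]
    exact (mul_le_of_le_one_right (abs_nonneg _) (hτ y)).trans (abs_sub_blockAverage_le (hD x y))
  have e2 : ∀ (u : X → ℝ), (∀ x, |u x| ≤ 1) →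
      ∑ x, u x * ∑ y, k x y * (τ y - m y) ≤ Fintype.card X * ε := fun u hu => by
    have : ∀ x, u x * ∑ y, k x y * (τ y - m y) ≤ ε := fun x => by
      refine (le_abs_self _).trans ?_
      rw [abs_mul]
      exact (mul_le_of_le_one_left (abs_nonneg _) (hu x)).trans (e1 x)
    simpa using Finset.sum_le_sum fun x (_ : x ∈ (Finset.univ : Finset X)) => this x
  have e3 : ∑ x, ∑ y, k x y * τ x * τ y = ∑ x, ∑ y, k x y * m x * m y +
      ∑ x, τ x * ∑ y, k x y * (τ y - m y) + ∑ x, m x * ∑ y, k x y * (τ y - m y) := by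
    have s1 : ∑ x, m x * ∑ y, k x y * (τ y - m y) = ∑ x, ∑ y, (k x y * τ x * m y - k x y * m x * m y) := by
      rw [Finset.sum_congr rfl fun x _ => Finset.mul_sum _ _ _, Finset.sum_comm]
      refine Finset.sum_congr rfl fun x _ => Finset.sum_congr rfl fun y _ => ?_
      rw [hks y x]
      ring
    rw [s1, ← Finset.sum_add_distrib, ← Finset.sum_add_distrib]
    refine Finset.sum_congr rfl fun x _ => ?_
    rw [Finset.mul_sum, ← Finset.sum_add_distrib, ← Finset.sum_add_distrib]
    exact Finset.sum_congr rfl fun y _ => by ring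
  -- `2 m x m y ≤ m x ^ 2 + m y ^ 2`, and the symmetric kernel has row and column sums one.
  have e4 : ∑ x, ∑ y, k x y * m x * m y ≤ ∑ x, m x ^ 2 := by
    calc ∑ x, ∑ y, k x y * m x * m y
        ≤ ∑ x, ∑ y, (k x y * m x ^ 2 / 2 + k x y * m y ^ 2 / 2) := by
          refine Finset.sum_le_sum fun x _ => Finset.sum_le_sum fun y _ => ?_
          nlinarith [mul_nonneg (hk0 x y) (sq_nonneg (m x - m y))]
      _ = ∑ x, ∑ y, k x y * m x ^ 2 / 2 + ∑ y, ∑ x, k x y * m y ^ 2 / 2 := by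
          simp_rw [Finset.sum_add_distrib]
          congr 1
          exact Finset.sum_comm
      _ = ∑ x, m x ^ 2 := by
          have : ∀ y, ∑ x, k x y = 1 := fun y => by
            rw [← hk1 y]
            exact Finset.sum_congr rfl fun x _ => hks x y
          simp_rw [← Finset.sum_div, ← Finset.sum_mul, hk1, this]
          simp only [one_mul]
          ring
  rw [e3]
  linarith [e2 τ hτ, e2 m hm1]

end BlockAverage

/-! ### The upper bound on the pressure -/

theorem abs_periodize_sub_le {g d : ℤ → ℝ} (hg : Summable g) (hd : Summable d) {L : ℕ} (hL : 0 < L)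
    {u v : ℤ} (h : ∀ k : ℤ, |g (u + k * L) - g (v + k * L)| ≤ d (u + k * L)) :
    |periodize g L u - periodize g L v| ≤ periodize d L u := by
  simp_rw [← Real.norm_eq_abs] at h ⊢
  unfold periodize
  rw [← (summable_periodize hg hL u).tsum_sub (summable_periodize hg hL v)]
  exact tsum_of_norm_bounded (summable_periodize hd hL u).hasSum h

theorem kacLine_le_blockAverage {g : ℤ → ℝ} {R : ℕ} (hg : IsFiniteRange g R)
    (hsymm : ∀ u, g (-u) = g u) (hsum : ∑' u, g u = 1) {n : ℕ} {η : ℝ}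
    (hη : ∀ u v : ℤ, |u - v| ≤ n → |g u - g v| ≤ η) {A : ℕ} (c : Fin A → ℕ)
    (hc : ∀ x y, c x = c y → |((x : ℕ) : ℤ) - ((y : ℕ) : ℤ)| ≤ n)
    {τ : Fin A → ℝ} (hτ : ∀ x, |τ x| ≤ 1) :
    kacLine g A τ ≤ 1 / 2 * ∑ x, blockAverage c τ x ^ 2 + A * (2 * (R + n) * η) := by
  rcases Nat.eq_zero_or_pos A with rfl | hA
  · simp [kacLine]
  -- A majorant of the oscillation of `g` over distance `n`: for `u` outside this interval, both `u`
  -- and every `v` within `n` of it are out of range, so `g` vanishes at both.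
  set d : ℤ → ℝ := fun u => if u ∈ Finset.Ico (-((R + n : ℕ) : ℤ)) ((R + n : ℕ) : ℤ) then η else 0
    with hd
  have hds : HasSum d (∑ u ∈ Finset.Ico (-((R + n : ℕ) : ℤ)) ((R + n : ℕ) : ℤ), d u) :=
    hasSum_sum_of_ne_finset_zero fun u hu => by simp only [hd, hu, if_false]
  have hdsum : ∑' u, d u = 2 * (R + n) * η := by
    rw [hds.tsum_eq]
    simp only [hd]
    rw [Finset.sum_ite_of_true (fun u hu => hu), Finset.sum_const, Int.card_Ico, nsmul_eq_mul]
    have : (((R + n : ℕ) : ℤ) - -((R + n : ℕ) : ℤ)).toNat = 2 * (R + n) := by omega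
    rw [this]
    push_cast
    ring
  have hdg : ∀ u v : ℤ, |u - v| ≤ n → |g u - g v| ≤ d u := by
    intro u v huv
    by_cases hu : u ∈ Finset.Ico (-((R + n : ℕ) : ℤ)) ((R + n : ℕ) : ℤ)
    · simp only [hd, hu, if_true]
      exact hη u v huv
    · simp only [hd, hu, if_false]
      rw [Finset.mem_Ico] at hu
      push_cast at hu
      rw [abs_le] at huv
      rw [hg.range u, hg.range v, sub_zero, abs_zero]
      all_goals rw [le_abs]; omega
  set k : Fin A → Fin A → ℝ := fun x y => periodize g A (((y : ℕ) : ℤ) - ((x : ℕ) : ℤ)) with hk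
  have h1 := sum_kernel_le_blockAverage (c := c) (k := k) (ε := 2 * (R + n) * η)
    (fun x y => periodize_nonneg hg.nonneg _ _)
    (fun x y => by
      simp only [hk]
      rw [← periodize_sub_comm hsymm, neg_sub])
    (fun x => (sum_periodize hg.summable hA _).trans hsum)
    (fun x y => periodize d A (((y : ℕ) : ℤ) - ((x : ℕ) : ℤ)))
    (fun x y z hzy => abs_periodize_sub_le hg.summable hds.summable hA fun j => hdg _ _ (by
      have := hc _ _ hzy.symm
      rwa [show ((y : ℕ) : ℤ) - ((x : ℕ) : ℤ) + j * A - (((z : ℕ) : ℤ) - ((x : ℕ) : ℤ) + j * A) =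
        ((y : ℕ) : ℤ) - ((z : ℕ) : ℤ) by ring]))
    (fun x => ((sum_periodize hds.summable hA _).trans hdsum).le) hτ
  -- Restoring the diagonal only increases the sum, since its terms are nonnegative.
  have h2 : ∑ x : Fin A, ∑ y : Fin A, (if y = x then 0 else
      periodize g A (((y : ℕ) : ℤ) - ((x : ℕ) : ℤ)) * τ x * τ y) ≤
      ∑ x, ∑ y, k x y * τ x * τ y := by
    refine Finset.sum_le_sum fun x _ => Finset.sum_le_sum fun y _ => ?_
    split_ifs with h
    · rw [h, mul_assoc]
      exact mul_nonneg (periodize_nonneg hg.nonneg _ _) (mul_self_nonneg _)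
    · exact le_rfl
  rw [Fintype.card_fin] at h1
  unfold kacLine
  linarith

theorem spin_eq (s : ℤˣ) : spin s = 2 * (if s = 1 then 1 else 0) - 1 := by
  rcases Int.units_eq_one_or s with h | h
  · norm_num [spin, h]
  · have : (-1 : ℤˣ) ≠ 1 := by decide
    norm_num [spin, h, this]

/-- A block average is determined by the number of plus spins in the block, an integer between `0`
and `n`; there are at most `Q` blocks in each layer. -/
theorem card_image_blockAverage_le {X B : Type*} [Fintype X] [Fintype B] [DecidableEq X] [DecidableEq B]
    [DecidableEq (X → B → ℝ)] {Q n : ℕ} (c : X → ℕ)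
    (hc : ∀ x, c x < Q) (hn : ∀ x, blockCard c x ≤ n) :
    (Finset.univ.image fun (σ : X → B → ℤˣ) (x : X) (i : B) =>
      blockAverage c (fun y => spin (σ y i)) x).card ≤ ((n + 1) ^ Fintype.card B) ^ Q := by
  set φ : (Fin Q → B → Fin (n + 1)) → X → B → ℝ := fun k x i =>
    (blockCard c x : ℝ)⁻¹ * (2 * ((k ⟨c x, hc x⟩ i : ℕ) : ℝ) - blockCard c x) with hφ
  have hsub : (Finset.univ.image fun (σ : X → B → ℤˣ) (x : X) (i : B) =>
      blockAverage c (fun y => spin (σ y i)) x) ⊆ Finset.univ.image φ := by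
    intro a ha
    obtain ⟨σ, -, rfl⟩ := Finset.mem_image.mp ha
    -- `Fin.ofNat` reduces modulo `n + 1`; this changes nothing at the blocks that occur, where the
    -- count is at most `n`.
    refine Finset.mem_image.mpr ⟨fun q i => Fin.ofNat (n + 1)
      (Finset.univ.filter fun y => c y = q ∧ σ y i = 1).card, Finset.mem_univ _, ?_⟩
    funext x i
    have hle : (Finset.univ.filter fun y => c y = c x ∧ σ y i = 1).card ≤ n := by
      refine (Finset.card_le_card ?_).trans (hn x)
      intro y hy
      simp only [Finset.mem_filter, Finset.mem_univ, true_and] at hy ⊢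
      exact hy.1
    simp only [hφ, blockAverage, Fin.val_ofNat, Nat.mod_eq_of_lt (Nat.lt_succ_of_le hle)]
    congr 1
    simp only [spin_eq, Finset.sum_sub_distrib, ← Finset.mul_sum, Finset.sum_const, nsmul_eq_mul,
      mul_one]
    rw [← Finset.sum_filter, Finset.filter_filter, Finset.sum_const, nsmul_eq_mul, mul_one]
    rfl
  refine (Finset.card_le_card hsub).trans (Finset.card_image_le.trans (le_of_eq ?_))
  simp

/-- The upper bound on the pressure by coarse graining each layer in blocks of length `n`. -/
theorem torusPressure_le {g : ℤ → ℝ} {R : ℕ} (hg : IsFiniteRange g R)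
    (hsymm : ∀ u, g (-u) = g u) (hsum : ∑' u, g u = 1) {n : ℕ} (hn : 0 < n) {η : ℝ}
    (hη : ∀ u v : ℤ, |u - v| ≤ n → |g u - g v| ≤ η) (lam h : ℝ) (A B : ℕ) :
    torusPressure g lam h A B ≤ A * meanFieldPressure lam h B + A * B * (2 * (R + n) * η) +
      (A / n + 1) * B * Real.log (n + 1) := by
  classical
  set c : Fin A → ℕ := fun x => x / n with hc
  have hcd : ∀ x y, c x = c y → |((x : ℕ) : ℤ) - ((y : ℕ) : ℤ)| ≤ n := by
    intro x y hxy
    simp only [hc] at hxy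
    have h1 := Nat.div_add_mod (x : ℕ) n
    have h2 := Nat.div_add_mod (y : ℕ) n
    have h3 := Nat.mod_lt (x : ℕ) hn
    have h4 := Nat.mod_lt (y : ℕ) hn
    rw [hxy] at h1
    rw [abs_le]
    omega
  have hcard : ∀ x, blockCard c x ≤ n := by
    intro x
    have : ((Finset.univ.filter fun y => c y = c x).map Fin.valEmbedding) ⊆
        Finset.Ico (n * ((x : ℕ) / n)) (n * ((x : ℕ) / n) + n) := by
      intro z hz
      simp only [Finset.mem_map, Finset.mem_filter, Finset.mem_univ, true_and,
        Fin.valEmbedding_apply] at hz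
      obtain ⟨y, hy, rfl⟩ := hz
      simp only [hc] at hy
      have h2 := Nat.div_add_mod (y : ℕ) n
      have h4 := Nat.mod_lt (y : ℕ) hn
      rw [hy] at h2
      rw [Finset.mem_Ico]
      omega
    have := Finset.card_le_card this
    simpa [blockCard] using this
  set K : Finset (Fin A → Fin B → ℝ) := Finset.univ.image fun (σ : Fin A → Fin B → ℤˣ) (x : Fin A)
    (i : Fin B) => blockAverage c (fun y => spin (σ y i)) x with hK
  -- The extra `1` accounts for a possibly incomplete last block.
  have hKcard : K.card ≤ ((n + 1) ^ B) ^ (A / n + 1) := by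
    have := card_image_blockAverage_le (B := Fin B) (Q := A / n + 1) c
      (fun x => Nat.lt_succ_of_le (Nat.div_le_div_right x.2.le)) hcard
    rwa [Fintype.card_fin] at this
  have hKpos : 0 < K.card := Finset.card_pos.mpr ((Finset.univ_nonempty).image _)
  have hlog : Real.log K.card ≤ (A / n + 1) * B * Real.log (n + 1) := by
    have h1 : (K.card : ℝ) ≤ (((n : ℝ) + 1) ^ B) ^ (A / n + 1) := by exact_mod_cast hKcard
    refine (Real.log_le_log (by exact_mod_cast hKpos) h1).trans ?_
    rw [Real.log_pow, Real.log_pow, ← mul_assoc]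
    have h2 : ((A / n : ℕ) : ℝ) ≤ (A : ℝ) / n := Nat.cast_div_le
    have h3 : 0 ≤ Real.log ((n : ℝ) + 1) :=
      Real.log_nonneg (by linarith [(Nat.cast_nonneg n : (0 : ℝ) ≤ n)])
    push_cast
    gcongr
  have := logSumExp_le_of_columns (lam := lam) (h := h) (torusWeight g lam h A B) K
    (fun a ha x i => by
      obtain ⟨σ, -, rfl⟩ := Finset.mem_image.mp ha
      exact abs_blockAverage_le (fun y => (abs_spin _).le) x)
    (A * B * (2 * (R + n) * η))
    -- The field assigned to `σ` is the array of its own block averages, for which the linearization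
    -- is exact.
    (fun σ => ⟨_, Finset.mem_image_of_mem _ (Finset.mem_univ σ), by
      rw [sum_chainLine_add_field]
      have h1 : ∑ i, kacLine g A (fun x => spin (σ x i)) ≤
          ∑ i : Fin B, (1 / 2 * ∑ x, blockAverage c (fun y => spin (σ y i)) x ^ 2 +
            A * (2 * (R + n) * η)) := Finset.sum_le_sum fun i _ =>
        kacLine_le_blockAverage hg hsymm hsum hη c hcd (fun x => (abs_spin _).le)
      have h2 : ∑ x, ∑ i, blockAverage c (fun y => spin (σ y i)) x * spin (σ x i) =
          ∑ i, ∑ x, blockAverage c (fun y => spin (σ y i)) x ^ 2 := by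
        rw [Finset.sum_comm]
        exact Finset.sum_congr rfl fun i _ => sum_blockAverage_mul (fun y => spin (σ y i))
      rw [Finset.sum_add_distrib, ← Finset.mul_sum, Finset.sum_const, nsmul_eq_mul,
        Finset.card_univ, Fintype.card_fin] at h1
      rw [h2, Finset.sum_comm (f := fun x i => blockAverage c (fun y => spin (σ y i)) x ^ 2)]
      unfold torusWeight
      linarith⟩)
  exact this.trans (add_le_add_right hlog _)

theorem tendsto_log_add_one_div :
    Tendsto (fun n : ℕ => 1 / (n : ℝ) * Real.log (n + 1)) atTop (𝓝 0) := by
  have h1 : Tendsto (fun x : ℝ => Real.log x / x) atTop (𝓝 0) := by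
    simpa using Real.tendsto_pow_log_div_mul_add_atTop 1 0 1 one_ne_zero
  have h2 : Tendsto (fun n : ℕ => Real.log ((n + 1 : ℕ) : ℝ) / ((n + 1 : ℕ) : ℝ)) atTop (𝓝 0) :=
    h1.comp (tendsto_natCast_atTop_atTop.comp (tendsto_add_atTop_nat 1))
  refine squeeze_zero' (Eventually.of_forall fun n => ?_) ?_
    (by simpa using h2.const_mul 2 : Tendsto (fun n : ℕ =>
      2 * (Real.log ((n + 1 : ℕ) : ℝ) / ((n + 1 : ℕ) : ℝ))) atTop (𝓝 0))
  · exact mul_nonneg (by positivity)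
      (Real.log_nonneg (by linarith [(Nat.cast_nonneg n : (0 : ℝ) ≤ n)]))
  · filter_upwards [eventually_ge_atTop 1] with n hn
    have hn' : (1 : ℝ) ≤ n := by exact_mod_cast hn
    have hl : 0 ≤ Real.log ((n : ℝ) + 1) := Real.log_nonneg (by linarith)
    push_cast
    rw [← mul_div_assoc, mul_comm (1 / (n : ℝ)), mul_one_div, mul_comm 2]
    rw [div_le_div_iff₀ (by linarith) (by linarith)]
    nlinarith

/-! ### The Kac coupling -/

/-- The Kac coupling as a function of the distance. -/
noncomputable def kacProfile (J : ℝ → ℝ → ℝ) (γ : ℝ) (u : ℤ) : ℝ := kacNorm J γ * γ * J 0 (γ * u)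

section Kac

variable {J : ℝ → ℝ → ℝ}

theorem kacCoupling_eq (hJ : IsKacKernel J) (γ : ℝ) (x y : ℤ) :
    kacCoupling J γ x y = kacProfile J γ (y - x) := by
  unfold kacCoupling kacProfile
  rw [← hJ.translation (γ * x) 0 (γ * ((y - x : ℤ) : ℝ))]
  push_cast
  ring_nf

theorem kacCouplingPer_eq (hJ : IsKacKernel J) (γ : ℝ) (L : ℕ) (x y : Fin L) :
    kacCouplingPer J γ L x y = periodize (kacProfile J γ) L (((y : ℕ) : ℤ) - ((x : ℕ) : ℤ)) := by
  unfold kacCouplingPer periodize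
  refine tsum_congr fun k => ?_
  rw [kacCoupling_eq hJ]
  congr 1
  ring

theorem neg_energy_eq (hJ : IsKacKernel J) (lam γ h : ℝ) (L : ℕ) (σ : SpinConfig L) :
    -energy J lam γ h L σ = torusWeight (kacProfile J γ) lam h L L σ := by
  have h1 : -kacEnergy J γ L σ = ∑ i, kacLine (kacProfile J γ) L (fun x => spin (σ x i)) := by
    unfold kacEnergy kacLine
    rw [← Finset.sum_neg_distrib]
    refine Finset.sum_congr rfl fun i _ => ?_
    rw [neg_neg]
    congr 1
    refine Finset.sum_congr rfl fun x _ => ?_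
    rw [Finset.sum_filter]
    refine Finset.sum_congr rfl fun y _ => ?_
    by_cases hy : y = x
    · simp [hy]
    · simp [hy, kacCouplingPer_eq hJ]
  have h2 : -vertEnergy lam L σ = ∑ x, chainLine lam L (fun i => spin (σ x i)) := by
    unfold vertEnergy chainLine
    rw [← Finset.sum_neg_distrib]
    simp
  have h3 : -fieldEnergy h L σ = h * ∑ x, ∑ i, spin (σ x i) := by
    unfold fieldEnergy
    simp only [neg_neg, Finset.mul_sum]
  unfold energy torusWeight
  rw [← h1, ← h2, ← h3]
  ring

theorem log_partitionFunction (hJ : IsKacKernel J) (lam γ h : ℝ) (L : ℕ) :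
    Real.log (partitionFunction J lam γ h L) = torusPressure (kacProfile J γ) lam h L L := by
  unfold partitionFunction torusPressure logSumExp
  simp_rw [neg_energy_eq hJ]

theorem kacNorm_nonneg (hJ : IsKacKernel J) {γ : ℝ} (hγ : 0 < γ) : 0 ≤ kacNorm J γ :=
  inv_nonneg.mpr (tsum_nonneg fun _ => mul_nonneg hγ.le (hJ.nonneg _ _))

theorem kernel_eq_zero (hJ : IsKacKernel J) {γ : ℝ} (hγ : 0 < γ) {u : ℤ}
    (hu : ((⌈1 / γ⌉₊ : ℕ) : ℤ) ≤ |u|) : J 0 (γ * u) = 0 := by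
  refine hJ.support _ _ ?_
  have h1 : 1 / γ ≤ |(u : ℝ)| := (Nat.le_ceil _).trans (by exact_mod_cast hu)
  rw [zero_sub, abs_neg, abs_mul, abs_of_pos hγ]
  rw [div_le_iff₀ hγ] at h1
  linarith

theorem isFiniteRange_kacProfile (hJ : IsKacKernel J) {γ : ℝ} (hγ : 0 < γ) :
    IsFiniteRange (kacProfile J γ) ⌈1 / γ⌉₊ where
  nonneg u := mul_nonneg (mul_nonneg (kacNorm_nonneg hJ hγ) hγ.le) (hJ.nonneg _ _)
  range u hu := by rw [kacProfile, kernel_eq_zero hJ hγ hu, mul_zero]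

theorem kacProfile_neg (hJ : IsKacKernel J) (γ : ℝ) (u : ℤ) :
    kacProfile J γ (-u) = kacProfile J γ u := by
  unfold kacProfile
  rw [← hJ.translation (γ * u) 0 (γ * ((-u : ℤ) : ℝ)), hJ.symm 0 (γ * (u : ℝ))]
  push_cast
  ring_nf

theorem tsum_kacProfile (hJ : IsKacKernel J) {γ : ℝ} (h : ∑' y : ℤ, γ * J 0 (γ * y) ≠ 0) :
    ∑' u, kacProfile J γ u = 1 := by
  have := (hasSum_kacCoupling hJ γ h 0).tsum_eq
  simpa [kacCoupling_eq hJ] using this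

/-- The normalization constant of the Kac coupling stays bounded as `γ → 0`. -/
theorem exists_le_tsum_kernel (hJ : IsKacKernel J) :
    ∃ c : ℝ, 0 < c ∧ ∀ᶠ γ : ℝ in 𝓝[>] 0, c ≤ ∑' y : ℤ, γ * J 0 (γ * y) := by
  have hcont : Continuous (J 0) := by
    have := hJ.smooth.continuous.comp (by fun_prop : Continuous fun r : ℝ => ((0 : ℝ), r))
    exact this
  obtain ⟨r, hr⟩ : ∃ r, 0 < J 0 r := by
    by_contra! hneg
    have h0 : ∀ r, J 0 r = 0 := fun r => le_antisymm (hneg r) (hJ.nonneg _ _)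
    have := hJ.integral_eq_one 0
    simp [h0] at this
  obtain ⟨δ, hδ, hball⟩ := Metric.continuousAt_iff.mp hcont.continuousAt (J 0 r / 2) (half_pos hr)
  have hlow : ∀ s, r ≤ s → s < r + δ → J 0 r / 2 ≤ J 0 s := fun s h1 h2 => by
    have := hball (show dist s r < δ by rw [Real.dist_eq, abs_lt]; constructor <;> linarith)
    rw [Real.dist_eq, abs_lt] at this
    linarith [this.1]
  refine ⟨δ / 2 * (J 0 r / 2), by positivity, ?_⟩
  filter_upwards [Ioo_mem_nhdsGT (half_pos hδ)] with γ hγ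
  have hγ0 : 0 < γ := hγ.1
  -- The points `γ z, …, γ (z + N - 1)` lie in `[r, r + δ)`, where `J 0` is at least half of `J 0
  -- r`, and `γ N ≥ δ / 2` because `γ < δ / 2`.
  set N := ⌊δ / γ⌋₊ with hN
  have hN1 : γ * N ≤ δ := by
    have := Nat.floor_le (div_nonneg hδ.le hγ0.le)
    rw [le_div_iff₀ hγ0] at this
    linarith
  have hN2 : δ / 2 ≤ γ * N := by
    have := Nat.lt_floor_add_one (δ / γ)
    rw [div_lt_iff₀ hγ0] at this
    linarith [hγ.2]
  set z : ℤ := ⌈r / γ⌉ with hz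
  have hz1 : r ≤ γ * z := by
    have := Int.le_ceil (r / γ)
    rw [div_le_iff₀ hγ0] at this
    linarith
  have hz2 : γ * z < r + γ := by
    have := Int.ceil_lt_add_one (r / γ)
    rw [← sub_lt_iff_lt_add, lt_div_iff₀ hγ0] at this
    linarith
  have hsum : Summable fun y : ℤ => γ * J 0 (γ * y) := by
    refine IsFiniteRange.summable (R := ⌈1 / γ⌉₊)
      ⟨fun u => mul_nonneg hγ0.le (hJ.nonneg _ _), fun u hu => ?_⟩
    rw [kernel_eq_zero hJ hγ0 hu, mul_zero]
  have hinj : Function.Injective fun j : ℕ => z + (j : ℤ) := fun a b hab => by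
    simpa using hab
  have h1 := hsum.sum_le_tsum ((Finset.range N).map ⟨_, hinj⟩)
    fun y _ => mul_nonneg hγ0.le (hJ.nonneg _ _)
  refine le_trans ?_ h1
  rw [Finset.sum_map]
  have h2 : ∑ j ∈ Finset.range N, γ * (J 0 r / 2) ≤ ∑ j ∈ Finset.range N,
      γ * J 0 (γ * (((⟨_, hinj⟩ : ℕ ↪ ℤ) j : ℤ) : ℝ)) := by
    refine Finset.sum_le_sum fun j hj => mul_le_mul_of_nonneg_left (hlow _ ?_ ?_) hγ0.le
    · simp only [Function.Embedding.coeFn_mk]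
      push_cast
      have : 0 ≤ γ * (j : ℝ) := by positivity
      linarith
    · simp only [Function.Embedding.coeFn_mk]
      have hj' : (j : ℝ) + 1 ≤ N := by exact_mod_cast Finset.mem_range.mp hj
      have := mul_le_mul_of_nonneg_left hj' hγ0.le
      push_cast
      linarith
  refine le_trans ?_ h2
  rw [Finset.sum_const, Finset.card_range, nsmul_eq_mul]
  have := mul_le_mul_of_nonneg_right hN2 (half_pos hr).le
  linarith

theorem exists_lipschitz_kernel (hJ : IsKacKernel J) :
    ∃ C : ℝ, 0 ≤ C ∧ ∀ r s, |J 0 r - J 0 s| ≤ C * |r - s| := by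
  have hsm : ContDiff ℝ ∞ (J 0) :=
    hJ.smooth.comp (by fun_prop : ContDiff ℝ ∞ fun r : ℝ => ((0 : ℝ), r))
  have hsupp : HasCompactSupport (J 0) := by
    refine HasCompactSupport.of_support_subset_isCompact (isCompact_Icc (a := -1) (b := 1)) ?_
    intro r hr
    by_contra h
    refine hr (hJ.support 0 r ?_)
    rw [zero_sub, abs_neg]
    by_contra h'
    exact h (abs_le.mp (not_le.mp h').le)
  obtain ⟨C, hC⟩ := hsm.lipschitzWith_of_hasCompactSupport hsupp (by simp)
  refine ⟨C, C.2, fun r s => ?_⟩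
  simpa [Real.dist_eq] using hC.dist_le_mul r s

/-- Comparison of the pressure with its mean field value. -/
theorem eventually_abs_pressure_sub_le (hJ : IsKacKernel J) (lam h : ℝ) {ε : ℝ} (hε : 0 < ε) :
    ∀ᶠ γ : ℝ in 𝓝[>] 0, ∀ᶠ L : ℕ in atTop,
      |1 / (L : ℝ) ^ 2 * torusPressure (kacProfile J γ) lam h L L -
        meanFieldPressure lam h L / L| ≤ ε := by
  obtain ⟨c, hc, hcγ⟩ := exists_le_tsum_kernel hJ
  obtain ⟨C, hC, hLip⟩ := exists_lipschitz_kernel hJ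
  -- The block length is fixed before `γ`, by the entropy term alone; then `γ` is taken small
  -- depending on `n`.
  obtain ⟨n, hn1, hn⟩ := ((tendsto_log_add_one_div.eventually (gt_mem_nhds (by linarith : (0 : ℝ) < ε / 4))).and
    (eventually_gt_atTop 0)).exists
  -- The energy error `2 (R + n) η`, with `R ≤ 1 / γ + 1` and `η = C n γ² / c`.
  have herr : Tendsto (fun γ : ℝ => 2 * (1 / c * C * n) * (γ + (1 + n) * γ ^ 2)) (𝓝[>] 0) (𝓝 0) := by
    have : Continuous (fun γ : ℝ => 2 * (1 / c * C * n) * (γ + (1 + n) * γ ^ 2)) := by fun_prop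
    have h0 := this.tendsto 0
    simp only [ne_eq, OfNat.ofNat_ne_zero, not_false_eq_true, zero_pow, mul_zero, add_zero] at h0
    exact h0.mono_left nhdsWithin_le_nhds
  have hdiag : Tendsto (fun γ : ℝ => 1 / c * γ * J 0 0) (𝓝[>] 0) (𝓝 0) := by
    have : Continuous (fun γ : ℝ => 1 / c * γ * J 0 0) := by fun_prop
    have h0 := this.tendsto 0
    simp only [mul_zero, zero_mul] at h0
    exact h0.mono_left nhdsWithin_le_nhds
  filter_upwards [hcγ, self_mem_nhdsWithin,
    herr.eventually (gt_mem_nhds (by linarith : (0 : ℝ) < ε / 4)),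
    hdiag.eventually (gt_mem_nhds hε)] with γ h1 hγ h2 h3
  have hγ0 : 0 < γ := hγ
  have hg := isFiniteRange_kacProfile hJ hγ0
  have hsum := tsum_kacProfile hJ (hc.trans_le h1).ne'
  have hnorm : kacNorm J γ ≤ 1 / c := by
    rw [kacNorm, one_div]
    exact inv_anti₀ hc h1
  have hnorm0 := kacNorm_nonneg hJ hγ0
  have hη : ∀ u v : ℤ, |u - v| ≤ n → |kacProfile J γ u - kacProfile J γ v| ≤
      1 / c * C * n * γ ^ 2 := by
    intro u v huv
    have huv' : |(u : ℝ) - v| ≤ n := by exact_mod_cast huv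
    unfold kacProfile
    rw [← mul_sub, abs_mul, abs_of_nonneg (mul_nonneg hnorm0 hγ0.le)]
    calc _ ≤ kacNorm J γ * γ * (C * |γ * u - γ * v|) :=
          mul_le_mul_of_nonneg_left (hLip _ _) (mul_nonneg hnorm0 hγ0.le)
      _ = kacNorm J γ * (γ ^ 2 * C * |(u : ℝ) - v|) := by
          rw [← mul_sub, abs_mul, abs_of_pos hγ0]
          ring
      _ ≤ 1 / c * (γ ^ 2 * C * n) := by gcongr
      _ = _ := by ring
  have hRle : ((⌈1 / γ⌉₊ : ℕ) : ℝ) ≤ 1 / γ + 1 := (Nat.ceil_lt_add_one (by positivity)).le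
  have hbound : 2 * (((⌈1 / γ⌉₊ : ℕ) : ℝ) + n) * (1 / c * C * n * γ ^ 2) ≤ ε / 4 := by
    refine le_trans ?_ h2.le
    calc _ ≤ 2 * (1 / γ + 1 + n) * (1 / c * C * n * γ ^ 2) := by gcongr
      _ = _ := by field_simp; ring
  have tL : Tendsto (fun L : ℕ => Real.log (n + 1) / (L : ℝ)) atTop (𝓝 0) :=
    tendsto_const_div_atTop_nhds_zero_nat _
  filter_upwards [tL.eventually (gt_mem_nhds (by linarith : (0 : ℝ) < ε / 4)),
    eventually_gt_atTop 0, eventually_ge_atTop ⌈1 / γ⌉₊] with L hL1 hL hLR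
  have hL' : (0 : ℝ) < L := by exact_mod_cast hL
  have up := torusPressure_le hg (kacProfile_neg hJ γ) hsum hn hη lam h L L
  have low := meanFieldPressure_le_torusPressure hg hsum lam h hL L
  -- Once `L ≥ R`, no image of a site interacts with the site itself, and the diagonal entry is `c_γ
  -- γ J(0, 0)`, of order `γ`.
  rw [periodize_eq_self hg (by omega) (by omega)] at low
  have hd : kacProfile J γ 0 ≤ ε := by
    refine le_trans ?_ h3.le
    unfold kacProfile
    rw [Int.cast_zero, mul_zero]
    have := hJ.nonneg 0 0
    gcongr
  rw [abs_le]
  constructor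
  · have e : 1 / (L : ℝ) ^ 2 * (L * meanFieldPressure lam h L - L * L * kacProfile J γ 0 / 2) =
        meanFieldPressure lam h L / L - kacProfile J γ 0 / 2 := by field_simp
    have := mul_le_mul_of_nonneg_left low (by positivity : (0 : ℝ) ≤ 1 / (L : ℝ) ^ 2)
    rw [e] at this
    linarith
  · have := mul_le_mul_of_nonneg_left up (by positivity : (0 : ℝ) ≤ 1 / (L : ℝ) ^ 2)
    have e : 1 / (L : ℝ) ^ 2 * (L * meanFieldPressure lam h L +
        L * L * (2 * (((⌈1 / γ⌉₊ : ℕ) : ℝ) + n) * (1 / c * C * n * γ ^ 2)) +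
        (L / n + 1) * L * Real.log (n + 1)) = meanFieldPressure lam h L / L +
        2 * (((⌈1 / γ⌉₊ : ℕ) : ℝ) + n) * (1 / c * C * n * γ ^ 2) +
        1 / n * Real.log (n + 1) + Real.log (n + 1) / L := by
      have hn' : (0 : ℝ) < n := by exact_mod_cast hn
      field_simp
      ring
    rw [e] at this
    linarith

end Kac

/-- Interchange of limits for a family which is uniformly close to a fixed sequence. -/
theorem exists_tendsto_of_eventually_abs_sub_le {A : ℝ → ℕ → ℝ} {b : ℕ → ℝ} {P : ℝ → ℝ}
    (hP : ∀ γ, 0 < γ → Tendsto (A γ) atTop (𝓝 (P γ)))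
    (h : ∀ ε : ℝ, 0 < ε → ∀ᶠ γ : ℝ in 𝓝[>] 0, ∀ᶠ L in atTop, |A γ L - b L| ≤ ε) :
    ∃ p, Tendsto b atTop (𝓝 p) ∧ Tendsto P (𝓝[>] 0) (𝓝 p) := by
  have hb : CauchySeq b := by
    refine Metric.cauchySeq_iff'.mpr fun ε hε => ?_
    -- A single small `γ` suffices: the convergent sequence `A γ` stays within `ε / 5` of `b`.
    obtain ⟨γ, hγ1, hγ⟩ := ((h (ε / 5) (by linarith)).and self_mem_nhdsWithin).exists
    have h1 := (hP γ hγ).eventually (Metric.ball_mem_nhds _ (by linarith : 0 < ε / 5))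
    obtain ⟨N, hN⟩ := eventually_atTop.mp (hγ1.and h1)
    refine ⟨N, fun L hL => ?_⟩
    obtain ⟨a1, a2⟩ := hN L hL
    obtain ⟨a3, a4⟩ := hN N le_rfl
    simp only [Real.dist_eq] at a2 a4 ⊢
    rw [abs_le] at a1 a3
    rw [abs_lt] at a2 a4 ⊢
    constructor <;> linarith [a1.1, a1.2, a2.1, a2.2, a3.1, a3.2, a4.1, a4.2]
  obtain ⟨p, hp⟩ := cauchySeq_tendsto_of_complete hb
  refine ⟨p, hp, Metric.tendsto_nhds.mpr fun ε hε => ?_⟩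
  filter_upwards [h (ε / 2) (by linarith), self_mem_nhdsWithin] with γ h1 hγ
  have := le_of_tendsto ((hP γ hγ).sub hp).abs h1
  rw [Real.dist_eq]
  linarith

/-! ### The magnetization of one column stays away from `±1` -/

/-- Reversal of the spin at `i`. -/
def flipAt {L : ℕ} (i : Fin L) : Equiv.Perm (Fin L → ℤˣ) :=
  Function.Involutive.toPerm (fun s => Function.update s i (-s i)) fun s => by simp

theorem flipAt_apply {L : ℕ} (i : Fin L) (s : Fin L → ℤˣ) :
    flipAt i s = Function.update s i (-s i) := rfl

theorem spin_neg (s : ℤˣ) : spin (-s) = -spin s := by simp [spin]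

/-- Only the bonds leaving and entering `i` are affected, and each changes by at most `2`. -/
theorem abs_chainLine_sub_le {lam : ℝ} (hl0 : 0 ≤ lam) (hl1 : lam ≤ 1) {L : ℕ} {τ τ' : Fin L → ℝ}
    (hτ : ∀ j, |τ j| ≤ 1) (hτ' : ∀ j, |τ' j| ≤ 1) {i : Fin L} (h : ∀ j, j ≠ i → τ j = τ' j) :
    |chainLine lam L τ - chainLine lam L τ'| ≤ 4 := by
  unfold chainLine
  rw [← mul_sub, abs_mul, abs_of_nonneg hl0]
  refine (mul_le_of_le_one_left (abs_nonneg _) hl1).trans ?_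
  rw [← Finset.sum_sub_distrib]
  refine (Finset.abs_sum_le_sum_abs _ _).trans ?_
  have h1 : ∀ j, |τ j * τ (finRotate L j) - τ' j * τ' (finRotate L j)| ≤
      (if j = i then 2 else 0) + (if finRotate L j = i then 2 else 0) := by
    intro j
    have hp : ∀ u : Fin L → ℝ, (∀ j, |u j| ≤ 1) → |u j * u (finRotate L j)| ≤ 1 := fun u hu => by
      rw [abs_mul]
      exact mul_le_one₀ (hu _) (abs_nonneg _) (hu _)
    have h2 := (abs_sub (τ j * τ (finRotate L j)) (τ' j * τ' (finRotate L j))).trans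
      (add_le_add (hp τ hτ) (hp τ' hτ'))
    by_cases hj : j = i
    · rw [if_pos hj]
      split_ifs <;> linarith
    · by_cases hr : finRotate L j = i
      · rw [if_neg hj, if_pos hr]
        linarith
      · rw [h j hj, h _ hr, sub_self, abs_zero, if_neg hj, if_neg hr, add_zero]
  refine (Finset.sum_le_sum fun j _ => h1 j).trans (le_of_eq ?_)
  rw [Finset.sum_add_distrib, Equiv.sum_comp (finRotate L) (fun j => if j = i then (2 : ℝ) else 0)]
  simp only [Finset.sum_ite_eq', Finset.mem_univ, if_true]
  norm_num

theorem abs_columnWeight_flipAt_sub_le {lam : ℝ} (hl0 : 0 ≤ lam) (hl1 : lam ≤ 1) {L : ℕ}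
    {b : Fin L → ℝ} {c : ℝ} (i : Fin L) (hb : |b i| ≤ c) (s : Fin L → ℤˣ) :
    |columnWeight lam L b (flipAt i s) - columnWeight lam L b s| ≤ 4 + 2 * c := by
  have h1 := abs_chainLine_sub_le hl0 hl1 (τ := fun j => spin (flipAt i s j))
    (τ' := fun j => spin (s j)) (fun j => (abs_spin _).le) (fun j => (abs_spin _).le) (i := i)
    (fun j hj => by simp [flipAt_apply, hj])
  have h2 : ∑ j, b j * spin (flipAt i s j) - ∑ j, b j * spin (s j) = -2 * (b i * spin (s i)) := by
    rw [← Finset.sum_sub_distrib, Fintype.sum_eq_single i]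
    · simp [flipAt_apply, spin_neg]
      ring
    · intro j hj
      simp [flipAt_apply, hj]
  have h3 : |-2 * (b i * spin (s i))| ≤ 2 * c := by
    rw [abs_mul, abs_mul, abs_spin, mul_one]
    norm_num
    exact hb
  unfold columnWeight
  rw [add_sub_add_comm, h2]
  exact (abs_add_le _ _).trans (add_le_add h1 h3)

/-- A bound on the magnetization of a column in a field bounded by `c`. -/
theorem gibbs_spin_le {lam : ℝ} (hl0 : 0 ≤ lam) (hl1 : lam ≤ 1) {L : ℕ} {b : Fin L → ℝ} {c : ℝ}
    (i : Fin L) (hb : |b i| ≤ c) {e : ℝ} (he : |e| = 1) :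
    e * gibbs (columnWeight lam L b) (fun s => spin (s i)) ≤
      (1 - Real.exp (-(4 + 2 * c))) / (1 + Real.exp (-(4 + 2 * c))) := by
  set W := columnWeight lam L b with hW
  set q := Real.exp (-(4 + 2 * c)) with hq
  set μ := gibbs W (fun s => spin (s i)) with hμ
  have hq0 : 0 < q := Real.exp_pos _
  have hpos := sum_exp_pos W
  -- `1 + e * spin (s i)` is twice the indicator that the spin at `i` equals `e`. Flipping it loses
  -- at most a factor `q`, so the opposite sign has at least `q` times the weight: `q (1 + e μ) ≤ 1
  -- - e μ`.
  have h1 : ∑ s, Real.exp (W s) * (1 + e * spin (s i)) * q ≤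
      ∑ s, Real.exp (W s) * (1 - e * spin (s i)) := by
    rw [← Equiv.sum_comp (flipAt i) (fun s => Real.exp (W s) * (1 - e * spin (s i)))]
    refine Finset.sum_le_sum fun s _ => ?_
    have hs : spin (flipAt i s i) = -spin (s i) := by simp [flipAt_apply, spin_neg]
    have hn : 0 ≤ 1 + e * spin (s i) := by
      have : |e * spin (s i)| ≤ 1 := by rw [abs_mul, he, abs_spin, mul_one]
      linarith [(abs_le.mp this).1]
    rw [hs, mul_right_comm, mul_neg, sub_neg_eq_add, hq, ← Real.exp_add]
    refine mul_le_mul_of_nonneg_right (Real.exp_le_exp.mpr ?_) hn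
    linarith [(abs_le.mp (abs_columnWeight_flipAt_sub_le hl0 hl1 i hb s)).1]
  have h2 : ∑ s, Real.exp (W s) * spin (s i) = μ * ∑ s, Real.exp (W s) := by
    rw [hμ, gibbs, div_mul_cancel₀ _ hpos.ne']
  have h3 : ∑ s, Real.exp (W s) * (1 + e * spin (s i)) * q =
      (∑ s, Real.exp (W s)) * ((1 + e * μ) * q) := by
    rw [← Finset.sum_mul]
    simp only [mul_add, mul_one, mul_left_comm _ e, Finset.sum_add_distrib, ← Finset.mul_sum, h2]
    ring
  have h4 : ∑ s, Real.exp (W s) * (1 - e * spin (s i)) =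
      (∑ s, Real.exp (W s)) * (1 - e * μ) := by
    simp only [mul_sub, mul_one, mul_left_comm _ e, Finset.sum_sub_distrib, ← Finset.mul_sum, h2]
    ring
  rw [h3, h4] at h1
  have h5 := le_of_mul_le_mul_left h1 hpos
  rw [le_div_iff₀ (by linarith)]
  linarith

/-- A function on two points is affine, so the exponential moment of a spin is an affine function of
its mean. -/
theorem exp_mul_spin {e : ℝ} (he : e = 1 ∨ e = -1) (s : ℤˣ) :
    Real.exp (e * spin s) = Real.cosh 1 + Real.sinh 1 * (e * spin s) := by
  have h : e * spin s = 1 ∨ e * spin s = -1 := by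
    rcases Int.units_eq_one_or s with h | h <;> rcases he with rfl | rfl <;> simp [spin, h]
  rcases h with h | h <;> rw [h]
  · rw [mul_one, Real.cosh_add_sinh]
  · rw [mul_neg_one, ← sub_eq_add_neg, Real.cosh_sub_sinh]

/-- Chernoff bound for the magnetization of a layer under independent columns. -/
theorem gibbs_exp_layer_le {lam : ℝ} {A B : ℕ} (b : Fin B → ℝ) (i : Fin B) {μ : ℝ} {e : ℝ}
    (he : e = 1 ∨ e = -1)
    (hμ : e * gibbs (columnWeight lam B b) (fun s => spin (s i)) ≤ μ) (M : ℝ) :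
    gibbs (fun σ : Fin A → Fin B → ℤˣ => ∑ x, columnWeight lam B b (σ x))
      (fun σ => Real.exp (e * ∑ x, spin (σ x i) - A * M)) ≤
      (Real.exp (-M) * (Real.cosh 1 + Real.sinh 1 * μ)) ^ A := by
  have h1 : (fun σ : Fin A → Fin B → ℤˣ => Real.exp (e * ∑ x, spin (σ x i) - A * M)) =
      fun σ => ∏ x, (Real.exp (-M) * Real.exp (e * spin (σ x i))) := by
    funext σ
    simp_rw [← Real.exp_add]
    rw [← Real.exp_sum, Finset.sum_add_distrib, ← Finset.mul_sum]
    simp only [Finset.sum_const, Finset.card_univ, Fintype.card_fin, nsmul_eq_mul]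
    ring_nf
  rw [h1, gibbs_pi (fun _ : Fin A => columnWeight lam B b)
    (fun _ s => Real.exp (-M) * Real.exp (e * spin (s i)))]
  rw [Finset.prod_const, Finset.card_univ, Fintype.card_fin]
  have h2 : 0 ≤ gibbs (columnWeight lam B b)
      (fun s => Real.exp (-M) * Real.exp (e * spin (s i))) := by
    rw [← gibbs_const (columnWeight lam B b) 0]
    exact gibbs_mono _ fun s => by positivity
  refine pow_le_pow_left₀ h2 ?_ A
  rw [gibbs_mul]
  simp_rw [exp_mul_spin he]
  rw [gibbs_add, gibbs_const, gibbs_mul, gibbs_mul]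
  have := Real.sinh_pos_iff.mpr one_pos
  gcongr

/-- With probability at least `1 / 2`, all the layers have magnetization in `[-M, M]`. -/
theorem half_le_gibbs_layers {lam : ℝ} {A B : ℕ} (b : Fin B → ℝ) {μ M : ℝ}
    (hμ : ∀ (e : ℝ), |e| = 1 → ∀ i, e * gibbs (columnWeight lam B b) (fun s => spin (s i)) ≤ μ)
    (hsmall : B * (2 * (Real.exp (-M) * (Real.cosh 1 + Real.sinh 1 * μ)) ^ A) ≤ 1 / 2)
    (G : (Fin A → Fin B → ℤˣ) → Prop) [DecidablePred G]
    (hG : ∀ σ, (∀ i, |∑ x, spin (σ x i)| ≤ A * M) → G σ) :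
    1 / 2 ≤ gibbs (fun σ : Fin A → Fin B → ℤˣ => ∑ x, columnWeight lam B b (σ x))
      (fun σ => if G σ then 1 else 0) := by
  set E : (Fin A → Fin B → ℤˣ) → ℝ := fun σ => ∑ x, columnWeight lam B b (σ x) with hE
  -- Union bound in Markov form: if `G` fails, some layer exceeds `A * M` in absolute value and one
  -- of its two exponentials is at least `1`.
  have h1 : gibbs E (fun _ => 1) ≤ gibbs E (fun σ => (if G σ then 1 else 0) +
      ∑ i, (Real.exp (1 * ∑ x, spin (σ x i) - A * M) +
        Real.exp (-1 * ∑ x, spin (σ x i) - A * M))) := by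
    refine gibbs_mono E fun σ => ?_
    have hn : ∀ i, 0 ≤ Real.exp (1 * ∑ x, spin (σ x i) - A * M) +
        Real.exp (-1 * ∑ x, spin (σ x i) - A * M) := fun i => by positivity
    split_ifs with hGσ
    · linarith [Finset.sum_nonneg fun i (_ : i ∈ (Finset.univ : Finset (Fin B))) => hn i]
    · obtain ⟨i, hi⟩ : ∃ i, (A : ℝ) * M < |∑ x, spin (σ x i)| := by
        by_contra! hcon
        exact hGσ (hG σ hcon)
      rw [zero_add]
      refine le_trans ?_ (Finset.single_le_sum (fun i _ => hn i) (Finset.mem_univ i))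
      rcases lt_abs.mp hi with h | h
      · have : 1 ≤ Real.exp (1 * ∑ x, spin (σ x i) - A * M) := Real.one_le_exp (by linarith)
        linarith [Real.exp_pos (-1 * ∑ x, spin (σ x i) - A * M)]
      · have : 1 ≤ Real.exp (-1 * ∑ x, spin (σ x i) - A * M) := Real.one_le_exp (by linarith)
        linarith [Real.exp_pos (1 * ∑ x, spin (σ x i) - A * M)]
  rw [gibbs_const, gibbs_add, gibbs_sum] at h1
  have h2 : ∀ i, gibbs E (fun σ => Real.exp (1 * ∑ x, spin (σ x i) - A * M) +
      Real.exp (-1 * ∑ x, spin (σ x i) - A * M)) ≤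
      2 * (Real.exp (-M) * (Real.cosh 1 + Real.sinh 1 * μ)) ^ A := fun i => by
    rw [gibbs_add, two_mul]
    exact add_le_add (gibbs_exp_layer_le b i (Or.inl rfl) (hμ 1 (by norm_num) i) M)
      (gibbs_exp_layer_le b i (Or.inr rfl) (hμ (-1) (by norm_num) i) M)
  have h3 := Finset.sum_le_sum fun i (_ : i ∈ (Finset.univ : Finset (Fin B))) => h2 i
  rw [Finset.sum_const, nsmul_eq_mul, Finset.card_univ, Fintype.card_fin] at h3
  linarith

/-! ### The maximum over the profiles -/

section Profiles

variable {lam h : ℝ} {ℓ : ℕ}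

/-- The energy, with the sign changed, of independent columns in the auxiliary field `a`. -/
noncomputable def profileWeight (lam h : ℝ) (ℓ : ℕ) (a : Fin ℓ → ℝ) (σ : SpinConfig ℓ) : ℝ :=
  ∑ x, columnWeight lam ℓ (fun i => h + a i) (σ x) - 1 / 2 * ∑ _x : Fin ℓ, ∑ i, a i ^ 2

theorem profileWeight_eq (a : Fin ℓ → ℝ) (σ : SpinConfig ℓ) :
    profileWeight lam h ℓ a σ = -vertEnergy lam ℓ σ +
      ∑ i, ((h + a i) * ∑ x, spin (σ x i) - ℓ * (a i ^ 2 / 2)) := by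
  have h2 : -vertEnergy lam ℓ σ = ∑ x, chainLine lam ℓ (fun i => spin (σ x i)) := by
    unfold vertEnergy chainLine
    rw [← Finset.sum_neg_distrib]
    simp
  rw [h2, profileWeight]
  unfold columnWeight
  rw [Finset.sum_add_distrib, Finset.sum_sub_distrib, Finset.sum_comm (f := fun x i =>
    (h + a i) * spin (σ x i))]
  simp only [Finset.mul_sum, Finset.sum_const, Finset.card_univ, Fintype.card_fin, nsmul_eq_mul]
  rw [add_sub_assoc]
  congr 2
  exact Finset.sum_congr rfl fun i _ => by ring

/-- By `a m - a² / 2 ≤ m² / 2`, the best auxiliary field for a configuration is its own profile of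
layer magnetizations. -/
theorem profileWeight_le {a m : Fin ℓ → ℝ} {σ : SpinConfig ℓ}
    (hσ : ∀ i, ∑ x, spin (σ x i) = ℓ * m i) :
    profileWeight lam h ℓ a σ ≤ profileWeight lam h ℓ m σ := by
  rw [profileWeight_eq, profileWeight_eq]
  refine add_le_add_right (Finset.sum_le_sum fun i _ => ?_) _
  rw [hσ]
  have : 0 ≤ (ℓ : ℝ) * (m i - a i) ^ 2 := by positivity
  nlinarith

theorem exists_config {m : Fin ℓ → ℝ} (hℓ : 0 < ℓ) (hm : ∀ i, m i ∈ magnetizations ℓ) :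
    ∃ σ : SpinConfig ℓ, ∀ i, ∑ x, spin (σ x i) = ℓ * m i := by
  choose k hk hmk using hm
  refine ⟨fun x i => if (x : ℕ) < k i then 1 else -1, fun i => ?_⟩
  have h1 : ∀ x : Fin ℓ, spin (if (x : ℕ) < k i then 1 else -1) =
      2 * (if (x : ℕ) < k i then 1 else 0) - 1 := fun x => by
    split_ifs <;> norm_num [spin]
  have h2 : (Finset.univ.filter fun x : Fin ℓ => (x : ℕ) < k i).card = k i := by
    rw [Fin.card_filter_val_lt]
    exact min_eq_right (hk i)
  simp_rw [h1]
  rw [Finset.sum_sub_distrib, ← Finset.mul_sum, ← Finset.sum_filter, Finset.sum_const, h2, hmk]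
  have : (ℓ : ℝ) ≠ 0 := by exact_mod_cast hℓ.ne'
  simp only [Finset.sum_const, Finset.card_univ, Fintype.card_fin, nsmul_eq_mul, mul_one]
  field_simp
  ring

open Classical in
-- On configurations with profile `m`, the field `a = m` contributes exactly `m² / 2 + h m` per
-- site, so the profile functional is a restricted partition function of the columns.
theorem exp_profileValue {m : Fin ℓ → ℝ} (hℓ : 0 < ℓ) (hm : ∀ i, m i ∈ magnetizations ℓ) :
    Real.exp (profileValue lam h ℓ m) =
      ∑ σ ∈ Finset.univ.filter (fun σ : SpinConfig ℓ => ∀ i, ∑ x, spin (σ x i) = ℓ * m i),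
        Real.exp (profileWeight lam h ℓ m σ) := by
  have hℓ' : (ℓ : ℝ) ≠ 0 := by exact_mod_cast hℓ.ne'
  -- Needed because `Real.log 0 = 0`: an empty constraint would give a wrong value.
  have hpos : 0 < constrainedPartition lam ℓ m := by
    obtain ⟨σ, hσ⟩ := exists_config hℓ hm
    exact Finset.sum_pos (fun _ _ => Real.exp_pos _) ⟨σ, by simpa using hσ⟩
  have h1 : profileValue lam h ℓ m = ∑ i, ℓ * (m i ^ 2 / 2 + h * m i) +
      Real.log (constrainedPartition lam ℓ m) := by
    unfold profileValue phi
    simp only [Finset.sum_sub_distrib, Finset.sum_const, Finset.card_univ, Fintype.card_fin,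
      nsmul_eq_mul, ← Finset.mul_sum]
    field_simp
    ring
  rw [h1, Real.exp_add, Real.exp_log hpos, constrainedPartition, Finset.mul_sum]
  refine Finset.sum_congr rfl fun σ hσ => ?_
  rw [← Real.exp_add, profileWeight_eq, add_comm]
  congr 2
  refine Finset.sum_congr rfl fun i _ => ?_
  rw [(Finset.mem_filter.mp hσ).2 i]
  ring

theorem logSumExp_profileWeight (a : Fin ℓ → ℝ) :
    logSumExp (profileWeight lam h ℓ a) = ℓ * meanFieldValue lam h ℓ a := by
  have := logSumExp_columns lam h ℓ ℓ (fun _ => a)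
  simp only [Finset.sum_const, Finset.card_univ, Fintype.card_fin, nsmul_eq_mul] at this
  rw [← this]
  unfold profileWeight
  simp

/-- Dropping the constraint on the layers, with the field `a = m` kept, only adds positive terms. -/
theorem profileValue_le {mplus : ℝ} (hM : mplus ≤ 1) (hℓ : 0 < ℓ) {m : Fin ℓ → ℝ}
    (hm : m ∈ profiles mplus ℓ) :
    profileValue lam h ℓ m ≤ ℓ * meanFieldPressure lam h ℓ := by
  classical
  have h1 : profileValue lam h ℓ m ≤ logSumExp (profileWeight lam h ℓ m) := by
    rw [← Real.exp_le_exp, exp_logSumExp, exp_profileValue hℓ fun i => (hm i).1]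
    exact Finset.sum_le_sum_of_subset_of_nonneg (Finset.filter_subset _ _)
      fun _ _ _ => (Real.exp_pos _).le
  rw [logSumExp_profileWeight] at h1
  exact h1.trans (mul_le_mul_of_nonneg_left
    (meanFieldValue_le lam h fun i => (hm i).2.trans hM) (Nat.cast_nonneg ℓ))

theorem card_profiles_le (mplus : ℝ) (ℓ : ℕ) :
    (finite_profiles mplus ℓ).toFinset.card ≤ (ℓ + 1) ^ ℓ := by
  classical
  have hsub : (finite_profiles mplus ℓ).toFinset ⊆
      Finset.univ.image fun (k : Fin ℓ → Fin (ℓ + 1)) (i : Fin ℓ) =>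
        -1 + 2 * ((k i : ℕ) : ℝ) / ℓ := by
    intro m hm
    rw [Set.Finite.mem_toFinset] at hm
    choose k hk hmk using fun i => (hm i).1
    refine Finset.mem_image.mpr ⟨fun i => ⟨k i, Nat.lt_succ_of_le (hk i)⟩, Finset.mem_univ _, ?_⟩
    funext i
    exact (hmk i).symm
  refine (Finset.card_le_card hsub).trans (Finset.card_image_le.trans (le_of_eq ?_))
  simp

theorem sum_spin_div_mem_magnetizations (hℓ : 0 < ℓ) (s : Fin ℓ → ℤˣ) :
    (∑ x, spin (s x)) / ℓ ∈ magnetizations ℓ := by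
  have hℓ' : (ℓ : ℝ) ≠ 0 := by exact_mod_cast hℓ.ne'
  refine ⟨(Finset.univ.filter fun x => s x = 1).card, ?_, ?_⟩
  · simpa using Finset.card_le_univ (Finset.univ.filter fun x => s x = 1)
  · simp_rw [spin_eq]
    rw [Finset.sum_sub_distrib, ← Finset.mul_sum, ← Finset.sum_filter, Finset.sum_const]
    simp only [Finset.sum_const, Finset.card_univ, Fintype.card_fin, nsmul_eq_mul, mul_one]
    field_simp
    ring

/-- The restriction of the profiles to `[-mplus, mplus]` is harmless if the layers have
magnetization in this interval with probability at least `1 / 2`. -/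
theorem nonempty_profiles_and_meanFieldValue_le {mplus : ℝ} (hℓ : 0 < ℓ) {a : Fin ℓ → ℝ}
    (hhalf : ∀ (G : SpinConfig ℓ → Prop) [DecidablePred G],
      (∀ σ, (∀ i, |∑ x, spin (σ x i)| ≤ ℓ * mplus) → G σ) →
      1 / 2 ≤ gibbs (fun σ : SpinConfig ℓ => ∑ x, columnWeight lam ℓ (fun i => h + a i) (σ x))
        (fun σ => if G σ then 1 else 0)) :
    (profiles mplus ℓ).Nonempty ∧ ℓ * meanFieldValue lam h ℓ a ≤
      logZmax lam h mplus ℓ + Real.log 2 + ℓ * Real.log (ℓ + 1) := by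
  classical
  have hℓ' : (0 : ℝ) < ℓ := by exact_mod_cast hℓ
  set S := (finite_profiles mplus ℓ).toFinset with hS
  set G : SpinConfig ℓ → Prop := fun σ =>
    ∃ m ∈ S, ∀ i, ∑ x, spin (σ x i) = ℓ * m i with hG
  have h0 := hhalf G fun σ hσ => by
    refine ⟨fun i => (∑ x, spin (σ x i)) / ℓ, ?_, fun i => by field_simp⟩
    rw [hS, Set.Finite.mem_toFinset]
    refine fun i => ⟨sum_spin_div_mem_magnetizations hℓ fun x => σ x i, ?_⟩
    rw [abs_div, abs_of_pos hℓ', div_le_iff₀ hℓ']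
    linarith [hσ i]
  -- With no admissible profile, `G` would have probability zero instead of at least `1 / 2`.
  have hne : (profiles mplus ℓ).Nonempty := by
    by_contra hemp
    have hS0 : S = ∅ := by
      rw [hS, Set.Finite.toFinset_eq_empty]
      exact Set.not_nonempty_iff_eq_empty.mp hemp
    have : (fun σ : SpinConfig ℓ => if G σ then (1 : ℝ) else 0) = fun _ => 0 := by
      funext σ
      simp [hG, hS0]
    rw [this, gibbs_const] at h0
    norm_num at h0
  have hSpos : (0 : ℝ) < S.card := by
    obtain ⟨m, hm⟩ := hne
    exact_mod_cast Finset.card_pos.mpr ⟨m, (Set.Finite.mem_toFinset _).mpr hm⟩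
  have h1 : 1 / 2 * Real.exp (ℓ * meanFieldValue lam h ℓ a) ≤
      ∑ σ : SpinConfig ℓ, Real.exp (profileWeight lam h ℓ a σ) * (if G σ then 1 else 0) := by
    rw [← logSumExp_profileWeight, exp_logSumExp]
    rw [gibbs, le_div_iff₀ (sum_exp_pos _)] at h0
    have hc : ∀ σ, Real.exp (profileWeight lam h ℓ a σ) =
        Real.exp (∑ x, columnWeight lam ℓ (fun i => h + a i) (σ x)) *
        Real.exp (-(1 / 2 * ∑ _x : Fin ℓ, ∑ i, a i ^ 2)) := fun σ => by
      rw [← Real.exp_add, ← sub_eq_add_neg, profileWeight]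
    simp_rw [hc, mul_right_comm _ (Real.exp (-(1 / 2 * ∑ _x : Fin ℓ, ∑ i, a i ^ 2)))]
    rw [← Finset.sum_mul, ← Finset.sum_mul, ← mul_assoc]
    exact mul_le_mul_of_nonneg_right h0 (Real.exp_pos _).le
  have h2 : ∑ σ : SpinConfig ℓ, Real.exp (profileWeight lam h ℓ a σ) * (if G σ then 1 else 0) ≤
      ∑ m ∈ S, Real.exp (profileValue lam h ℓ m) := by
    have e : ∀ m ∈ S, Real.exp (profileValue lam h ℓ m) = ∑ σ : SpinConfig ℓ,
        if ∀ i, ∑ x, spin (σ x i) = ℓ * m i then Real.exp (profileWeight lam h ℓ m σ) else 0 := by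
      intro m hm
      rw [hS, Set.Finite.mem_toFinset] at hm
      rw [exp_profileValue hℓ fun i => (hm i).1, Finset.sum_filter]
    rw [Finset.sum_congr rfl e, Finset.sum_comm]
    -- A configuration in `G` has an admissible profile `m`; replacing `a` by `m` increases its
    -- weight and puts it in the sum for `m`.
    refine Finset.sum_le_sum fun σ _ => ?_
    have hnn : ∀ m ∈ S, 0 ≤ if ∀ i, ∑ x, spin (σ x i) = ℓ * m i then
        Real.exp (profileWeight lam h ℓ m σ) else 0 := fun m _ => by
      split_ifs
      · exact (Real.exp_pos _).le
      · exact le_rfl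
    by_cases hσ : G σ
    · obtain ⟨m, hm, hσm⟩ := hσ
      refine le_trans ?_ (Finset.single_le_sum hnn hm)
      rw [if_pos ⟨m, hm, hσm⟩, if_pos hσm, mul_one]
      exact Real.exp_le_exp.mpr (profileWeight_le hσm)
    · rw [if_neg hσ, mul_zero]
      exact Finset.sum_nonneg hnn
  have h3 : ∑ m ∈ S, Real.exp (profileValue lam h ℓ m) ≤
      S.card * Real.exp (logZmax lam h mplus ℓ) := by
    rw [← nsmul_eq_mul]
    refine Finset.sum_le_card_nsmul _ _ _ fun m hm => Real.exp_le_exp.mpr ?_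
    exact (isGreatest_logZmax lam h mplus ℓ hne).2
      ⟨m, (Set.Finite.mem_toFinset _).mp hm, rfl⟩
  have h4 := Real.log_le_log (by positivity) (h1.trans (h2.trans h3))
  rw [Real.log_mul (by norm_num) (Real.exp_pos _).ne', Real.log_exp,
    Real.log_mul hSpos.ne' (Real.exp_pos _).ne', Real.log_exp, one_div, Real.log_inv] at h4
  have h5 : Real.log S.card ≤ ℓ * Real.log (ℓ + 1) := by
    rw [← Real.log_pow]
    refine Real.log_le_log hSpos ?_
    exact_mod_cast card_profiles_le mplus ℓ
  exact ⟨hne, by linarith⟩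

end Profiles

/-! ### The cutoff and the limit of the maximum over profiles -/

/-- The choice of the cutoff: for `M` close to `1` the Chernoff factor is smaller than `1`. -/
theorem exists_cutoff {μ : ℝ} (hμ0 : 0 ≤ μ) (hμ1 : μ < 1) :
    ∃ M : ℝ, 0 < M ∧ M < 1 ∧ 0 ≤ Real.exp (-M) * (Real.cosh 1 + Real.sinh 1 * μ) ∧
      Real.exp (-M) * (Real.cosh 1 + Real.sinh 1 * μ) < 1 := by
  have hs := Real.sinh_pos_iff.mpr one_pos
  have hc := Real.cosh_pos 1
  have hcont : Continuous fun M : ℝ => Real.exp (-M) * (Real.cosh 1 + Real.sinh 1 * μ) := by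
    fun_prop
  -- At `M = 1` the factor is `(cosh 1 + μ sinh 1) / (cosh 1 + sinh 1)`, below one as `μ < 1`;
  -- continuity leaves room for some `M < 1`.
  have h1 : Real.exp (-1) * (Real.cosh 1 + Real.sinh 1 * μ) < 1 := by
    rw [Real.exp_neg, inv_mul_lt_iff₀ (Real.exp_pos 1), mul_one, ← Real.cosh_add_sinh]
    nlinarith
  have hev : ∀ᶠ M in 𝓝[<] (1 : ℝ), Real.exp (-M) * (Real.cosh 1 + Real.sinh 1 * μ) < 1 :=
    ((hcont.tendsto 1).eventually (gt_mem_nhds h1)).filter_mono nhdsWithin_le_nhds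
  obtain ⟨M, hM, hM0, hM1⟩ := (hev.and (Ioo_mem_nhdsLT one_pos)).exists
  exact ⟨M, hM0, hM1, by positivity, hM⟩

/-- The Chernoff factor `θ < 1` is the same for every auxiliary field in `[-1, 1]`, so the union
bound `2 ℓ θ ^ ℓ` is eventually at most `1 / 2` uniformly in the field, and the supremum over fields
may be taken afterwards. -/
theorem eventually_logZmax_bounds {lam h c mplus : ℝ} (hl0 : 0 ≤ lam) (hl1 : lam ≤ 1)
    (hc : |h| + 1 ≤ c) (hM1 : mplus ≤ 1)
    (h0 : 0 ≤ Real.exp (-mplus) * (Real.cosh 1 + Real.sinh 1 *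
      ((1 - Real.exp (-(4 + 2 * c))) / (1 + Real.exp (-(4 + 2 * c))))))
    (h1 : Real.exp (-mplus) * (Real.cosh 1 + Real.sinh 1 *
      ((1 - Real.exp (-(4 + 2 * c))) / (1 + Real.exp (-(4 + 2 * c))))) < 1) :
    ∀ᶠ ℓ : ℕ in atTop, logZmax lam h mplus ℓ ≤ ℓ * meanFieldPressure lam h ℓ ∧
      ℓ * meanFieldPressure lam h ℓ ≤
        logZmax lam h mplus ℓ + Real.log 2 + ℓ * Real.log (ℓ + 1) := by
  set θ := Real.exp (-mplus) * (Real.cosh 1 + Real.sinh 1 *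
      ((1 - Real.exp (-(4 + 2 * c))) / (1 + Real.exp (-(4 + 2 * c))))) with hθ
  have ht : Tendsto (fun ℓ : ℕ => (ℓ : ℝ) * θ ^ ℓ) atTop (𝓝 0) :=
    tendsto_self_mul_const_pow_of_lt_one h0 h1
  filter_upwards [ht.eventually (gt_mem_nhds (by norm_num : (0 : ℝ) < 1 / 4)),
    eventually_gt_atTop 0] with ℓ hℓ1 hℓ
  have hℓ' : (0 : ℝ) < ℓ := by exact_mod_cast hℓ
  have key : ∀ a : Fin ℓ → ℝ, (∀ i, |a i| ≤ 1) → (profiles mplus ℓ).Nonempty ∧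
      ℓ * meanFieldValue lam h ℓ a ≤
        logZmax lam h mplus ℓ + Real.log 2 + ℓ * Real.log (ℓ + 1) := by
    intro a ha
    refine nonempty_profiles_and_meanFieldValue_le hℓ fun G _ hG =>
      half_le_gibbs_layers (fun i => h + a i) (fun e he i => gibbs_spin_le (c := c) hl0 hl1 i ?_ he)
        ?_ G hG
    · exact ((abs_add_le _ _).trans (add_le_add_right (ha i) _)).trans hc
    · linarith
  constructor
  · obtain ⟨m, hm, hmv⟩ := (isGreatest_logZmax lam h mplus ℓ (key 0 fun i => by simp).1).1
    rw [← hmv]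
    exact profileValue_le hM1 hℓ hm
  · rw [mul_comm, ← le_div_iff₀ hℓ']
    refine meanFieldPressure_le fun a ha => ?_
    rw [le_div_iff₀ hℓ', mul_comm]
    exact (key a ha).2

theorem tendsto_of_logZmax_bounds {lam h mplus p : ℝ}
    (hp : Tendsto (fun L : ℕ => meanFieldPressure lam h L / L) atTop (𝓝 p))
    (hb : ∀ᶠ ℓ : ℕ in atTop, logZmax lam h mplus ℓ ≤ ℓ * meanFieldPressure lam h ℓ ∧
      ℓ * meanFieldPressure lam h ℓ ≤
        logZmax lam h mplus ℓ + Real.log 2 + ℓ * Real.log (ℓ + 1)) :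
    Tendsto (fun ℓ : ℕ => 1 / (ℓ : ℝ) ^ 2 * logZmax lam h mplus ℓ) atTop (𝓝 p) := by
  have hlow : Tendsto (fun ℓ : ℕ => meanFieldPressure lam h ℓ / ℓ - 1 / ℓ * (Real.log 2 / ℓ) -
      1 / (ℓ : ℝ) * Real.log (ℓ + 1)) atTop (𝓝 (p - 0 * 0 - 0)) :=
    (hp.sub (tendsto_one_div_atTop_nhds_zero_nat.mul
      (tendsto_const_div_atTop_nhds_zero_nat _))).sub tendsto_log_add_one_div
  simp only [mul_zero, sub_zero] at hlow
  refine tendsto_of_tendsto_of_tendsto_of_le_of_le' hlow hp ?_ ?_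
  all_goals
    filter_upwards [hb, eventually_gt_atTop 0] with ℓ hℓb hℓ
    have hℓ' : (0 : ℝ) < ℓ := by exact_mod_cast hℓ
  · have := mul_le_mul_of_nonneg_left hℓb.2 (by positivity : (0 : ℝ) ≤ 1 / (ℓ : ℝ) ^ 2)
    have e1 : 1 / (ℓ : ℝ) ^ 2 * (ℓ * meanFieldPressure lam h ℓ) =
      meanFieldPressure lam h ℓ / ℓ := by field_simp
    have e2 : 1 / (ℓ : ℝ) ^ 2 * (logZmax lam h mplus ℓ + Real.log 2 + ℓ * Real.log (ℓ + 1)) =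
      1 / (ℓ : ℝ) ^ 2 * logZmax lam h mplus ℓ + 1 / ℓ * (Real.log 2 / ℓ) +
        1 / ℓ * Real.log (ℓ + 1) := by field_simp
    rw [e1, e2] at this
    linarith
  · have := mul_le_mul_of_nonneg_left hℓb.1 (by positivity : (0 : ℝ) ≤ 1 / (ℓ : ℝ) ^ 2)
    have e1 : 1 / (ℓ : ℝ) ^ 2 * (ℓ * meanFieldPressure lam h ℓ) =
      meanFieldPressure lam h ℓ / ℓ := by field_simp
    rwa [e1] at this

end KacIsing

/-! ### Conclusion -/

theorem mainTheorem9 (hStar : ℝ) (hStar_gt : 3 < hStar)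
    (hStar_eq : 3 / Real.cosh (hStar - 3) ^ 2 = 1 / 4) :
    ∃ mplus : ℝ, 0 < mplus ∧ mplus < 1 ∧
      ∀ J : ℝ → ℝ → ℝ, KacIsing.IsKacKernel J →
      ∀ lam : ℝ, 0 ≤ lam → lam < 1 →
      ∀ h : ℝ, 0 ≤ h → h ≤ hStar →
        ∃ (P : ℝ → ℝ) (p : ℝ),
          (∀ γ : ℝ, 0 < γ →
            Tendsto (fun L : ℕ =>
              1 / (L : ℝ) ^ 2 * Real.log (KacIsing.partitionFunction J lam γ h L))
              atTop (𝓝 (P γ))) ∧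
          Tendsto P (𝓝[>] 0) (𝓝 p) ∧
          Tendsto (fun ℓ : ℕ => 1 / (ℓ : ℝ) ^ 2 * KacIsing.logZmax lam h mplus ℓ)
            atTop (𝓝 p) := by
  -- The total field `h + a i` is at most `hStar + 1` in absolute value, so the cutoff depends on
  -- `hStar` only, not on `J`, `lam` or `h`.
  set q := Real.exp (-(4 + 2 * (hStar + 1))) with hq
  have hq0 : 0 < q := Real.exp_pos _
  have hq1 : q ≤ 1 := Real.exp_le_one_iff.mpr (by linarith)
  obtain ⟨M, hM0, hM1, hθ0, hθ1⟩ := KacIsing.exists_cutoff (μ := (1 - q) / (1 + q))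
    (div_nonneg (by linarith) (by linarith)) (by rw [div_lt_one (by linarith)]; linarith)
  refine ⟨M, hM0, hM1, fun J hJ lam hl0 hl1 h hh0 hh1 => ?_⟩
  -- The implication is kept inside the existential so that `choose` gives a function on all of `ℝ`;
  -- its value for `γ ≤ 0` is irrelevant.
  have hP : ∀ γ : ℝ, ∃ P : ℝ, 0 < γ → Tendsto (fun L : ℕ =>
      1 / (L : ℝ) ^ 2 * Real.log (KacIsing.partitionFunction J lam γ h L)) atTop (𝓝 P) := by
    intro γ
    by_cases hγ : 0 < γ
    · obtain ⟨P, hP⟩ := KacIsing.exists_tendsto_torusPressure (h := h)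
        (KacIsing.isFiniteRange_kacProfile hJ hγ) hl0 hl1.le
      simp_rw [KacIsing.log_partitionFunction hJ]
      exact ⟨P, fun _ => hP⟩
    · exact ⟨0, fun h => absurd h hγ⟩
  choose P hP using hP
  obtain ⟨p, hp, hPp⟩ := KacIsing.exists_tendsto_of_eventually_abs_sub_le hP
    (b := fun L => KacIsing.meanFieldPressure lam h L / L) fun ε hε => by
      simp_rw [KacIsing.log_partitionFunction hJ]
      exact KacIsing.eventually_abs_pressure_sub_le hJ lam h hε
  refine ⟨P, p, hP, hPp, KacIsing.tendsto_of_logZmax_bounds hp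
    (KacIsing.eventually_logZmax_bounds hl0 hl1.le ?_ hM1.le hθ0 hθ1)⟩
  rw [abs_of_nonneg hh0]
  linarith
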